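/- **Agnostic upper bound for quantum online multiclass classification.** *Model.* Let $\mathcal X$ be a set, $\mathcal Y$ a finite set with $|\mathcal Y| = k > 2$, and $\mathcal H \subseteq \mathcal Y^{\mathcal X}$ a nonempty hypothesis class. In round $t = 1,\dots,T$ of the agnostic quantum online protocol: 1. the learner produces a hypothesis $h_t : \mathcal X \to \mathcal Y$ by a measurement of its quantum memory; 2. the adversary chooses a (discrete) probability distribution $D_t$ on $\mathcal X \times \mathcal Y$ and reveals the quantum example $|\psi_t\rangle = \sum_{x,y} \sqrt{D_t(x,y)}\,|x,y\rangle \in \ell^2(\mathcal X\times\mathcal Y)$; here $D_t$ may depend on everything observed in the earlier rounds (the hypotheses $h_1,\dots,h_{t-1}$ and the learner's earlier measurement outcomes), but not on the random outcome $h_t$ of round $t$; 3. the learner incurs the loss $\mathbb P_{(x,y)\sim D_t}[h_t(x)\ne y]$, which it does not see, and measures the joint system of its memory and $|\psi_t\rangle$, which yields a classical outcome and a new state of the memory. A quantum online learner is a choice of the memory (a Hilbert space with a unit initial state) and of these measurements, given by measurement operators $\{M_m\}$ with $\sum_m M_m^\dagger M_m = I$, which may depend on the classical outcomes of the past. The agnostic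 regret is $$\mathcal R^{\mathrm{agnostic}} = \sum_{t=1}^T \mathbb P_{(x,y)\sim D_t}[h_t(x)\neq y] \;-\; \inf_{h\in\mathcal H}\sum_{t=1}^T \mathbb P_{(x,y)\sim D_t}[h(x)\neq y],$$ and its expectation is over all measurement outcomes. The multiclass Littlestone dimension $\mathrm{mcLdim}(\mathcal H)$ is the largest depth of a complete binary tree, with internal nodes labelled by elements of $\mathcal X$ and the two edges below each node labelled by two different elements of $\mathcal Y$, such that for every root-to-leaf path some $h\in\mathcal H$ satisfies: for each node $x$ on the path, $h(x)$ is the label of the edge by which the path leaves that node. *Theorem.* There is a universal constant $C>0$ such that for all $\mathcal X$, $\mathcal Y$, $k$, $\mathcal H$ as above with $\mathrm{mcLdim}(\mathcal H)<\infty$ and every $T\ge 2$ there is a quantum online learner that satisfies, against every such adversary, $$\mathbb E\big[\mathcal R^{\mathrm{agnostic}}\big] \;\le\; C\sqrt{\mathrm{mcLdim}(\mathcal H)\cdot T\log T\cdot k\log k}.$$ -/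

import Mathlib

universe u v

noncomputable section

/-! ### Multiclass Littlestone dimension -/

/-- Complete binary trees of depth `n`: internal nodes carry elements of `X`, and the two edges
below a node carry two different elements of `Y`. -/
inductive MCTree (X : Type u) (Y : Type v) : ℕ → Type (max u v)
  | leaf : MCTree X Y 0
  | node {n : ℕ} (x : X) (y₀ y₁ : Y) (hne : y₀ ≠ y₁) (left right : MCTree X Y n) :
      MCTree X Y (n + 1)

/-- The root-to-leaf paths of a tree. A path is listed as the pairs
(label of the node, label of the edge by which the path leaves the node). -/
def MCTree.paths {X : Type u} {Y : Type v} : {n : ℕ} → MCTree X Y n → Set (List (X × Y))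
  | _, .leaf => {[]}
  | _, .node x y₀ y₁ _ left right =>
      (List.cons (x, y₀) '' left.paths) ∪ (List.cons (x, y₁) '' right.paths)

/-- The tree `t` is mcL-shattered by `H`. -/
def MCTree.ShatteredBy {X : Type u} {Y : Type v} {n : ℕ} (t : MCTree X Y n)
    (H : Set (X → Y)) : Prop :=
  ∀ p ∈ t.paths, ∃ h ∈ H, ∀ e ∈ p, h e.1 = e.2

/-- The multiclass Littlestone dimension of `H` (`⊤` if trees of unbounded depth are shattered). -/
def mcLdim {X : Type u} {Y : Type v} (H : Set (X → Y)) : ℕ∞ :=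
  ⨆ (n : ℕ) (_ : ∃ t : MCTree X Y n, t.ShatteredBy H), (n : ℕ∞)

/-! ### Quantum systems, examples and measurements -/

/-- The Hilbert space `ℓ²(S)` with orthonormal basis `|s⟩`, `s ∈ S`. The space of a system
composed of `ℓ²(S)` and `ℓ²(S')` is `ℓ²(S × S')`. -/
abbrev StateSpace (S : Type*) : Type _ := lp (fun _ : S => ℂ) 2

theorem StateSpace.hasSum_norm_sq {S : Type*} (φ : StateSpace S) :
    HasSum (fun s => ‖φ s‖ ^ 2) (‖φ‖ ^ 2) := by
  have h := lp.hasSum_norm (p := 2) (by norm_num) φ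
  simpa using h

/-- The product state `φ ⊗ ψ`. -/
def StateSpace.tensor {S S' : Type*} (φ : StateSpace S) (ψ : StateSpace S') :
    StateSpace (S × S') :=
  ⟨fun p => φ p.1 * ψ p.2, by
    refine memℓp_gen ?_
    have h := φ.hasSum_norm_sq.summable.mul_of_nonneg ψ.hasSum_norm_sq.summable
      (fun _ => by positivity) (fun _ => by positivity)
    simpa [mul_pow] using h⟩

theorem StateSpace.norm_sq_tensor {S S' : Type*} (φ : StateSpace S) (ψ : StateSpace S') :
    ‖φ.tensor ψ‖ ^ 2 = ‖φ‖ ^ 2 * ‖ψ‖ ^ 2 := by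
  have hs := φ.hasSum_norm_sq.summable.mul_of_nonneg ψ.hasSum_norm_sq.summable
      (fun _ => by positivity) (fun _ => by positivity)
  have h := φ.hasSum_norm_sq.mul ψ.hasSum_norm_sq hs
  refine (φ.tensor ψ).hasSum_norm_sq.unique ?_
  simpa [StateSpace.tensor, mul_pow] using h

theorem PMF.hasSum_toReal {Z : Type*} (D : PMF Z) : HasSum (fun z => (D z).toReal) 1 := by
  have h := ENNReal.hasSum_toReal (f := fun z => D z) (by rw [D.tsum_coe]; simp)
  simpa [← ENNReal.tsum_toReal_eq D.apply_ne_top] using h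

/-- The quantum example `∑ z, √(D z) |z⟩`. -/
def quantumExample {Z : Type*} (D : PMF Z) : StateSpace Z :=
  ⟨fun z => ((Real.sqrt (D z).toReal : ℝ) : ℂ), by
    refine memℓp_gen ?_
    simpa using D.hasSum_toReal.summable⟩

theorem norm_sq_quantumExample {Z : Type*} (D : PMF Z) : ‖quantumExample D‖ ^ 2 = 1 := by
  refine (quantumExample D).hasSum_norm_sq.unique ?_
  simpa [quantumExample] using D.hasSum_toReal

/-- A quantum measurement with outcomes in `Ω`, given by measurement operators `M_m` with
`∑ m, M_m† M_m = 1` (tested on vectors: `∑ m, ⟨φ, M_m† M_m φ⟩ = ⟨φ, φ⟩`). In state `φ`, a unit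
vector, outcome `m` has probability `‖M_m φ‖²` and leaves the state `M_m φ / ‖M_m φ‖`. -/
structure Measurement (Ω S S' : Type*) where
  op : Ω → StateSpace S →L[ℂ] StateSpace S'
  complete : ∀ φ : StateSpace S, HasSum (fun m => ‖op m φ‖ ^ 2) (‖φ‖ ^ 2)

/-! ### The quantum online model -/

/-- A quantum online learner with a quantum memory `ℓ²(Mem)`. In each round it first measures its
memory to obtain the hypothesis it plays (`predict`). It then receives an example, a state in
`ℓ²(X × Y)`, and measures the system composed of its memory and the example (`update`), which
leaves it with a new state of the memory. Both measurements may depend on the classical record of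
the past: the hypotheses played and the outcomes of the updates, the most recent round first. -/
structure QuantumLearner (X : Type u) (Y : Type v) where
  Mem : Type (max u v)
  Out : Type (max u v)
  init : StateSpace Mem
  norm_init : ‖init‖ = 1
  predict : List ((X → Y) × Out) → Measurement (X → Y) Mem Mem
  update : List ((X → Y) × Out) → (X → Y) → Measurement Out (Mem × (X × Y)) Mem

/-- The classical record of some rounds, the most recent round first. -/
abbrev QuantumLearner.Record {X : Type u} {Y : Type v} (L : QuantumLearner X Y) :
    Type (max u v) :=
  List ((X → Y) × L.Out)

/-- An adaptive adversary: the distribution `D_t` depends on the record of the rounds before `t`,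
but not on the hypothesis that the learner's measurement yields in round `t`. -/
abbrev Adversary {X : Type u} {Y : Type v} (L : QuantumLearner X Y) : Type (max u v) :=
  L.Record → PMF (X × Y)

/-- The memory after the rounds of a record, not normalized: its squared norm is the probability
that these rounds have this record. -/
def QuantumLearner.state {X : Type u} {Y : Type v} (L : QuantumLearner X Y) (A : Adversary L) :
    L.Record → StateSpace L.Mem
  | [] => L.init
  | (h, m) :: past =>
      (L.update past h).op m
        ((((L.predict past).op h (L.state A past))).tensor (quantumExample (A past)))

theorem Measurement.tsum_ofReal {Ω S S' : Type*} (M : Measurement Ω S S') (φ : StateSpace S) :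
    ∑' m, ENNReal.ofReal (‖M.op m φ‖ ^ 2) = ENNReal.ofReal (‖φ‖ ^ 2) := by
  rw [← ENNReal.ofReal_tsum_of_nonneg (fun _ => by positivity) (M.complete φ).summable,
    (M.complete φ).tsum_eq]

theorem QuantumLearner.tsum_state {X : Type u} {Y : Type v} (L : QuantumLearner X Y)
    (A : Adversary L) (T : ℕ) :
    ∑' r : List.Vector ((X → Y) × L.Out) T, ENNReal.ofReal (‖L.state A r.toList‖ ^ 2) = 1 := by
  induction T with
  | zero =>
    rw [tsum_eq_single List.Vector.nil (fun r hr => absurd (Subsingleton.elim _ _) hr)]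
    simp [QuantumLearner.state, L.norm_init]
  | succ T ih =>
    let e : ((X → Y) × L.Out) × List.Vector ((X → Y) × L.Out) T ≃
        List.Vector ((X → Y) × L.Out) (T + 1) :=
      { toFun := fun p => p.1 ::ᵥ p.2
        invFun := fun r => (r.head, r.tail)
        left_inv := fun p => by simp
        right_inv := fun r => by simp }
    rw [← e.tsum_eq, ENNReal.tsum_prod', ENNReal.tsum_comm, ← ih]
    refine tsum_congr fun r => ?_
    rw [ENNReal.tsum_prod', ← (L.predict r.toList).tsum_ofReal (L.state A r.toList)]
    refine tsum_congr fun h => ?_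
    have := (L.update r.toList h).tsum_ofReal
      (((L.predict r.toList).op h (L.state A r.toList)).tensor (quantumExample (A r.toList)))
    rw [StateSpace.norm_sq_tensor, norm_sq_quantumExample, mul_one] at this
    rw [← this]
    refine tsum_congr fun m => ?_
    simp [e, QuantumLearner.state]

/-- The law of the record of the first `T` rounds. -/
def QuantumLearner.law {X : Type u} {Y : Type v} (L : QuantumLearner X Y) (A : Adversary L)
    (T : ℕ) : PMF (List.Vector ((X → Y) × L.Out) T) :=
  ⟨fun r => ENNReal.ofReal (‖L.state A r.toList‖ ^ 2),
    (L.tsum_state A T) ▸ ENNReal.summable.hasSum⟩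

/-- `P_{(x, y) ∼ D} [h(x) ≠ y]`. -/
def risk {X : Type u} {Y : Type v} (D : PMF (X × Y)) (h : X → Y) : ℝ :=
  (D.toOuterMeasure {z | h z.1 ≠ z.2}).toReal

/-- The total loss of the learner over the rounds of a record. -/
def learnerLoss {X : Type u} {Y : Type v} {L : QuantumLearner X Y} (A : Adversary L) :
    L.Record → ℝ
  | [] => 0
  | (h, _) :: past => risk (A past) h + learnerLoss A past

/-- The total loss that the fixed hypothesis `g` would have had over the rounds of a record. -/
def fixedLoss {X : Type u} {Y : Type v} {L : QuantumLearner X Y} (A : Adversary L) (g : X → Y) :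
    L.Record → ℝ
  | [] => 0
  | _ :: past => risk (A past) g + fixedLoss A g past

/-- The agnostic regret with respect to `H` over the rounds of a record. -/
def agnosticRegret {X : Type u} {Y : Type v} {L : QuantumLearner X Y} (H : Set (X → Y))
    (A : Adversary L) (r : L.Record) : ℝ :=
  learnerLoss A r - ⨅ g : H, fixedLoss A g r

/-- The expected agnostic regret of the learner `L` against the adversary `A` after `T` rounds.
The sum converges absolutely, see `summable_expectedRegret`. -/
def expectedAgnosticRegret {X : Type u} {Y : Type v} (H : Set (X → Y)) (L : QuantumLearner X Y)
    (A : Adversary L) (T : ℕ) : ℝ :=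
  ∑' r : List.Vector ((X → Y) × L.Out) T,
    (L.law A T r).toReal * agnosticRegret H A r.toList

theorem risk_mem {X : Type u} {Y : Type v} (D : PMF (X × Y)) (h : X → Y) :
    0 ≤ risk D h ∧ risk D h ≤ 1 := by
  refine ⟨ENNReal.toReal_nonneg, ENNReal.toReal_le_of_le_ofReal zero_le_one ?_⟩
  rw [ENNReal.ofReal_one, PMF.toOuterMeasure_apply, ← D.tsum_coe]
  exact ENNReal.tsum_le_tsum fun z => Set.indicator_le_self _ _ _

theorem learnerLoss_mem {X : Type u} {Y : Type v} {L : QuantumLearner X Y} (A : Adversary L)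
    (r : L.Record) : 0 ≤ learnerLoss A r ∧ learnerLoss A r ≤ r.length := by
  induction r with
  | nil => simp [learnerLoss]
  | cons a past ih =>
    have := risk_mem (A past) a.1
    simp only [learnerLoss, List.length_cons, Nat.cast_add, Nat.cast_one]
    constructor <;> linarith

theorem fixedLoss_mem {X : Type u} {Y : Type v} {L : QuantumLearner X Y} (A : Adversary L)
    (g : X → Y) (r : L.Record) : 0 ≤ fixedLoss A g r ∧ fixedLoss A g r ≤ r.length := by
  induction r with
  | nil => simp [fixedLoss]
  | cons a past ih =>
    have := risk_mem (A past) g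
    simp only [fixedLoss, List.length_cons, Nat.cast_add, Nat.cast_one]
    constructor <;> linarith

theorem abs_agnosticRegret_le {X : Type u} {Y : Type v} {L : QuantumLearner X Y}
    (H : Set (X → Y)) (A : Adversary L) (r : L.Record) :
    |agnosticRegret H A r| ≤ r.length := by
  have h₁ := learnerLoss_mem A r
  have h₂ : 0 ≤ ⨅ g : H, fixedLoss A g r := Real.iInf_nonneg fun g => (fixedLoss_mem A g r).1
  have h₃ : ⨅ g : H, fixedLoss A g r ≤ r.length := by
    rcases isEmpty_or_nonempty H with hH | ⟨⟨g⟩⟩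
    · simp
    · exact (ciInf_le ⟨0, by rintro _ ⟨g, rfl⟩; exact (fixedLoss_mem A g r).1⟩ g).trans
        (fixedLoss_mem A g r).2
  rw [agnosticRegret, abs_le]
  constructor <;> linarith

theorem summable_expectedRegret {X : Type u} {Y : Type v} (H : Set (X → Y))
    (L : QuantumLearner X Y) (A : Adversary L) (T : ℕ) :
    Summable fun r : List.Vector ((X → Y) × L.Out) T =>
      (L.law A T r).toReal * agnosticRegret H A r.toList := by
  refine Summable.of_norm_bounded ((L.law A T).hasSum_toReal.summable.mul_right (T : ℝ)) ?_
  intro r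
  rw [norm_mul, Real.norm_of_nonneg ENNReal.toReal_nonneg]
  refine mul_le_mul_of_nonneg_left ?_ ENNReal.toReal_nonneg
  simpa using abs_agnosticRegret_le H A r.toList

end

/-!
The learner measures each example in the computational basis. As `D_t` may not depend on the
hypothesis drawn in round `t`, the measured example is independent of that hypothesis given the
past, and the problem becomes classical: predict from one random example per round, against
distributions chosen adaptively, with the regret measured in risks and not in mistakes. The regret
splits into two parts.

* The regret on the measured examples. For a class that shatters no tree of depth `c + 1`, all
  labels of a point but one, the prediction `soa`, leave a fiber that shatters no tree of depth `c`
  (`not_shatters_fiber_of_ne_soa`). So each hypothesis of `H` can be followed by restricting the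
  version space to the fiber of the prediction, except at `mcLdim H` rounds or fewer, where one of
  the `k` labels has to be guessed. Exponential weights over these strategies, with prior factor
  `b = 1 / (k T)` for a guess, have regret at most
  `(1 + T a ^ 2 + mcLdim H * log (k T)) / a` (`mul_totalMixtureLoss_hedge_le`).

* The deviation, maximized over `g ∈ H`, of the number of mistakes of `g` from the sum of its risks
  (`deviationValue_indicator_le`). Its exponential moment is bounded by induction on the number of
  remaining rounds, for all version spaces at once. In a round, the risk is replaced by the loss on
  a ghost example, by Jensen's inequality, and the version space is split by the labels of the two
  examples. The bound for the remaining rounds depends on the fibers only, so the two examples may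
  be exchanged, which yields a factor `cosh a ≤ exp (a ^ 2 / 2)`. The sum over the fibers is
  controlled by a Sauer-type recursion (`sum_sauerBound_fiber_le`).

Both parts are of order `√(mcLdim H * T * log (k T))` for `a = √(mcLdim H * log (k T) / T)`. If
`mcLdim H = 0`, then `H` has only one element, and the learner always plays it.
-/

open scoped ENNReal

/-! ### Shattered trees and version spaces -/

/-- `H` mcL-shatters some complete binary tree of depth `n`. -/
def Shatters {X : Type u} {Y : Type v} (n : ℕ) (H : Set (X → Y)) : Prop :=
  ∃ t : MCTree X Y n, t.ShatteredBy H

/-- The hypotheses of `V` that label `x` by `y`. -/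
def fiber {X : Type u} {Y : Type v} (V : Set (X → Y)) (x : X) (y : Y) : Set (X → Y) :=
  {g | g ∈ V ∧ g x = y}

section Shattering

variable {X : Type u} {Y : Type v}

theorem fiber_subset (V : Set (X → Y)) (x : X) (y : Y) : fiber V x y ⊆ V := fun _ h => h.1

theorem fiber_comm (V : Set (X → Y)) (x x' : X) (y y' : Y) :
    fiber (fiber V x y) x' y' = fiber (fiber V x' y') x y := by
  ext g
  simp only [fiber, Set.mem_ofPred_eq]
  tauto

theorem Shatters.mono {n : ℕ} {V W : Set (X → Y)} (hVW : V ⊆ W) (h : Shatters n V) :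
    Shatters n W := by
  obtain ⟨t, ht⟩ := h
  refine ⟨t, fun p hp => ?_⟩
  obtain ⟨g, hg, hgp⟩ := ht p hp
  exact ⟨g, hVW hg, hgp⟩

theorem shatters_zero {V : Set (X → Y)} : Shatters 0 V ↔ V.Nonempty := by
  constructor
  · rintro ⟨t, ht⟩
    cases t
    obtain ⟨g, hg, -⟩ := ht [] (by simp [MCTree.paths])
    exact ⟨g, hg⟩
  · rintro ⟨g, hg⟩
    refine ⟨.leaf, fun p hp => ⟨g, hg, ?_⟩⟩
    simp only [MCTree.paths, Set.mem_singleton_iff] at hp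
    simp [hp]

theorem shatters_succ {n : ℕ} {V : Set (X → Y)} :
    Shatters (n + 1) V ↔
      ∃ x y₀ y₁, y₀ ≠ y₁ ∧ Shatters n (fiber V x y₀) ∧ Shatters n (fiber V x y₁) := by
  constructor
  · rintro ⟨t, ht⟩
    cases t with
    | node x y₀ y₁ hne l r =>
      refine ⟨x, y₀, y₁, hne, ⟨l, fun p hp => ?_⟩, ⟨r, fun p hp => ?_⟩⟩
      · obtain ⟨g, hg, hgp⟩ := ht ((x, y₀) :: p) (Or.inl ⟨p, hp, rfl⟩)
        rw [List.forall_mem_cons] at hgp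
        exact ⟨g, ⟨hg, hgp.1⟩, hgp.2⟩
      · obtain ⟨g, hg, hgp⟩ := ht ((x, y₁) :: p) (Or.inr ⟨p, hp, rfl⟩)
        rw [List.forall_mem_cons] at hgp
        exact ⟨g, ⟨hg, hgp.1⟩, hgp.2⟩
  · rintro ⟨x, y₀, y₁, hne, ⟨l, hl⟩, ⟨r, hr⟩⟩
    refine ⟨.node x y₀ y₁ hne l r, ?_⟩
    rintro p (⟨q, hq, rfl⟩ | ⟨q, hq, rfl⟩)
    · obtain ⟨g, hg, hgp⟩ := hl q hq
      exact ⟨g, hg.1, List.forall_mem_cons.2 ⟨hg.2, hgp⟩⟩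
    · obtain ⟨g, hg, hgp⟩ := hr q hq
      exact ⟨g, hg.1, List.forall_mem_cons.2 ⟨hg.2, hgp⟩⟩

theorem Shatters.of_succ {n : ℕ} {V : Set (X → Y)} (h : Shatters (n + 1) V) : Shatters n V := by
  induction n generalizing V with
  | zero =>
    obtain ⟨x, y₀, y₁, -, h₀, -⟩ := shatters_succ.1 h
    exact h₀.mono (fiber_subset V x y₀)
  | succ n ih =>
    obtain ⟨x, y₀, y₁, hne, h₀, h₁⟩ := shatters_succ.1 h
    exact shatters_succ.2 ⟨x, y₀, y₁, hne, ih h₀, ih h₁⟩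

theorem Shatters.of_le {m n : ℕ} (hmn : m ≤ n) {V : Set (X → Y)} (h : Shatters n V) :
    Shatters m V := by
  induction n, hmn using Nat.le_induction with
  | base => exact h
  | succ n _ ih => exact ih h.of_succ

theorem not_shatters_of_mcLdim_eq {H : Set (X → Y)} {d : ℕ} (h : mcLdim H = d) :
    ¬ Shatters (d + 1) H := by
  intro hs
  have : ((d + 1 : ℕ) : ℕ∞) ≤ mcLdim H :=
    le_iSup₂ (f := fun (n : ℕ) (_ : ∃ t : MCTree X Y n, t.ShatteredBy H) => (n : ℕ∞)) (d + 1) hs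
  rw [h, Nat.cast_le] at this
  omega

/-- A class that shatters no tree of depth one has at most one element. -/
theorem subsingleton_of_not_shatters_one {H : Set (X → Y)} (h : ¬ Shatters 1 H) :
    H.Subsingleton := by
  intro f hf g hg
  funext x
  by_contra hne
  exact h (shatters_succ.2 ⟨x, f x, g x, hne, shatters_zero.2 ⟨f, hf, rfl⟩,
    shatters_zero.2 ⟨g, hg, rfl⟩⟩)

open Classical in
/-- The prediction of the standard optimal algorithm with version space `V`: the label whose fiber
has the same dimension as `V`. If `c` is the least depth at which `V` shatters no tree, this is the
label, at most one, whose fiber shatters a tree of depth `c - 1`; if there is none, all labels lower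
the dimension and an arbitrary one is chosen. -/
noncomputable def soa [Nonempty Y] (V : Set (X → Y)) (x : X) : Y :=
  if h : ∃ y, Shatters (sInf {c | ¬ Shatters c V} - 1) (fiber V x y) then h.choose
  else Classical.arbitrary Y

/-- A label other than the prediction of the standard optimal algorithm lowers the dimension. -/
theorem not_shatters_fiber_of_ne_soa [Nonempty Y] {V : Set (X → Y)} {c : ℕ}
    (hV : ¬ Shatters (c + 1) V) {x : X} {y : Y} (hy : y ≠ soa V x) :
    ¬ Shatters c (fiber V x y) := by
  classical
  intro hs
  have hmem : sInf {c | ¬ Shatters c V} ∈ {c | ¬ Shatters c V} := Nat.sInf_mem ⟨c + 1, hV⟩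
  have hle : sInf {c | ¬ Shatters c V} ≤ c + 1 := Nat.sInf_le hV
  have hdef : soa V x = if h : ∃ y, Shatters (sInf {c | ¬ Shatters c V} - 1) (fiber V x y)
    then h.choose else Classical.arbitrary Y := by
    unfold soa
    congr
  generalize sInf {c | ¬ Shatters c V} = m at hmem hle hdef
  cases m with
  | zero => exact hmem ((hs.of_le (Nat.zero_le c)).mono (fiber_subset V x y))
  | succ m =>
    rw [Nat.add_sub_cancel] at hdef
    have hsm : Shatters m (fiber V x y) := hs.of_le (by omega)
    have hex : ∃ y, Shatters m (fiber V x y) := ⟨y, hsm⟩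
    rw [dif_pos hex] at hdef
    refine hmem (shatters_succ.2 ⟨x, y, soa V x, hy, hsm, ?_⟩)
    rw [hdef]
    exact hex.choose_spec

end Shattering

/-! ### A Sauer-type bound -/

/-- The bound for the number of ways in which a class that shatters no tree of depth `c` can
label the points met along a branch of length `n`, for `k` labels. -/
def sauerNumber (k : ℕ) : ℕ → ℕ → ℕ
  | _, 0 => 0
  | 0, _ + 1 => 1
  | n + 1, c + 1 => sauerNumber k n (c + 1) + k * sauerNumber k n c

theorem sauerNumber_succ_le (k n c : ℕ) : sauerNumber k n (c + 1) ≤ (1 + k * n) ^ c := by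
  induction n generalizing c with
  | zero => simp [sauerNumber]
  | succ n ih =>
    cases c with
    | zero => simpa [sauerNumber] using ih 0
    | succ c =>
      calc sauerNumber k (n + 1) (c + 1 + 1)
          = sauerNumber k n (c + 1 + 1) + k * sauerNumber k n (c + 1) := rfl
        _ ≤ (1 + k * n) ^ (c + 1) + k * (1 + k * n) ^ c :=
          Nat.add_le_add (ih _) (Nat.mul_le_mul_left k (ih _))
        _ = (1 + k * (n + 1)) * (1 + k * n) ^ c := by ring
        _ ≤ (1 + k * (n + 1)) * (1 + k * (n + 1)) ^ c := by gcongr; omega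
        _ = (1 + k * (n + 1)) ^ (c + 1) := by ring

/-- The Sauer number of a version space, for branches of length `n`. -/
noncomputable def sauerBound {X : Type u} {Y : Type v} (n : ℕ) (V : Set (X → Y)) : ℝ≥0∞ :=
  ⨅ (c : ℕ) (_ : ¬ Shatters c V), (sauerNumber (Nat.card Y) n c : ℝ≥0∞)

section Sauer

variable {X : Type u} {Y : Type v}

theorem sauerBound_le {n c : ℕ} {V : Set (X → Y)} (hV : ¬ Shatters c V) :
    sauerBound n V ≤ sauerNumber (Nat.card Y) n c :=
  iInf₂_le (f := fun (c : ℕ) (_ : ¬ Shatters c V) => (sauerNumber (Nat.card Y) n c : ℝ≥0∞)) c hV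

theorem one_le_sauerBound_zero {V : Set (X → Y)} (hV : V.Nonempty) : 1 ≤ sauerBound 0 V := by
  refine le_iInf₂ fun c hc => ?_
  cases c with
  | zero => exact absurd (shatters_zero.2 hV) hc
  | succ c => simp [sauerNumber]

/-- Splitting a version space by the label of a point costs one step of the branch. -/
theorem sum_sauerBound_fiber_le [Fintype Y] (n : ℕ) (V : Set (X → Y)) (x : X) :
    ∑ y, sauerBound n (fiber V x y) ≤ sauerBound (n + 1) V := by
  classical
  refine le_iInf₂ fun c hc => ?_
  cases c with
  | zero =>
    refine le_of_eq_of_le (Finset.sum_eq_zero fun y _ => ?_) (by simp)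
    have h0 : ¬ Shatters 0 (fiber V x y) := fun h => hc (h.mono (fiber_subset V x y))
    simpa [sauerNumber] using sauerBound_le (n := n) h0
  | succ c =>
    rcases isEmpty_or_nonempty Y with hY | hY
    · simp
    · rw [← Finset.add_sum_erase _ _ (Finset.mem_univ (soa V x))]
      simp only [sauerNumber, Nat.cast_add, Nat.cast_mul]
      refine add_le_add (sauerBound_le fun h => hc (h.mono (fiber_subset V x _))) ?_
      calc ∑ y ∈ Finset.univ.erase (soa V x), sauerBound n (fiber V x y)
          ≤ ∑ y ∈ Finset.univ.erase (soa V x), (sauerNumber (Nat.card Y) n c : ℝ≥0∞) :=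
            Finset.sum_le_sum fun y hy =>
              sauerBound_le (not_shatters_fiber_of_ne_soa hc (Finset.ne_of_mem_erase hy))
        _ ≤ ∑ _y : Y, (sauerNumber (Nat.card Y) n c : ℝ≥0∞) :=
            Finset.sum_le_sum_of_subset (Finset.erase_subset _ _)
        _ = _ := by simp

end Sauer

/-! ### Zero-one loss -/

section Loss

variable {X : Type u} {Y : Type v}

open Classical in
/-- The zero-one loss of the label `y` when the true label is `b`. -/
noncomputable def labelLoss (y b : Y) : ℝ := if y = b then 0 else 1

theorem labelLoss_nonneg (y b : Y) : 0 ≤ labelLoss y b := by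
  unfold labelLoss; split_ifs <;> norm_num

theorem labelLoss_le_one (y b : Y) : labelLoss y b ≤ 1 := by
  unfold labelLoss; split_ifs <;> norm_num

theorem ofReal_risk (D : PMF (X × Y)) (g : X → Y) :
    ENNReal.ofReal (risk D g) = ∑' z, D z * ENNReal.ofReal (labelLoss (g z.1) z.2) := by
  classical
  have hne : D.toOuterMeasure {z | g z.1 ≠ z.2} ≠ ∞ := by
    refine ne_top_of_le_ne_top ENNReal.one_ne_top ?_
    rw [PMF.toOuterMeasure_apply, ← D.tsum_coe]
    exact ENNReal.tsum_le_tsum fun z => Set.indicator_le_self _ _ _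
  rw [risk, ENNReal.ofReal_toReal hne, PMF.toOuterMeasure_apply]
  refine tsum_congr fun z => ?_
  by_cases hz : g z.1 = z.2 <;> simp [Set.indicator, labelLoss, hz]

theorem hasSum_risk (D : PMF (X × Y)) (g : X → Y) :
    HasSum (fun z => (D z).toReal * labelLoss (g z.1) z.2) (risk D g) := by
  have h := ofReal_risk D g
  have hs := ENNReal.hasSum_toReal (f := fun z => D z * ENNReal.ofReal (labelLoss (g z.1) z.2))
    (by rw [← h]; exact ENNReal.ofReal_ne_top)
  rw [← ENNReal.tsum_toReal_eq, ← h, ENNReal.toReal_ofReal (risk_mem D g).1] at hs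
  · simpa [ENNReal.toReal_mul, ENNReal.toReal_ofReal (labelLoss_nonneg _ _)] using hs
  · exact fun z => ENNReal.mul_ne_top (D.apply_ne_top z) ENNReal.ofReal_ne_top

end Loss

/-- The exponential function with values in `ℝ≥0∞`. -/
noncomputable def expENN (x : ℝ) : ℝ≥0∞ := ENNReal.ofReal (Real.exp x)

theorem expENN_add (x y : ℝ) : expENN (x + y) = expENN x * expENN y := by
  rw [expENN, Real.exp_add, ENNReal.ofReal_mul (Real.exp_nonneg x)]; rfl

theorem expENN_mul_sub (a x y : ℝ) :
    expENN (a * (x - y)) = expENN (a * x) * expENN (-(a * y)) := by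
  rw [← expENN_add]; ring_nf

theorem expENN_zero : expENN 0 = 1 := by simp [expENN]

/-- Jensen's inequality for the loss of a hypothesis on a random example. -/
theorem expENN_neg_risk_le {X : Type u} {Y : Type v} (a : ℝ) (D : PMF (X × Y)) (g : X → Y) :
    expENN (-(a * risk D g)) ≤ ∑' z, D z * expENN (-(a * labelLoss (g z.1) z.2)) := by
  have hD := D.hasSum_toReal
  have hR := hasSum_risk D g
  -- The loss takes the values `0` and `1` only, so that `exp (-a ℓ)` is affine in `ℓ`.
  have hS : HasSum (fun z => (D z).toReal * Real.exp (-(a * labelLoss (g z.1) z.2)))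
      (1 + risk D g * (Real.exp (-a) - 1)) := by
    have hpt : (fun z => (D z).toReal * Real.exp (-(a * labelLoss (g z.1) z.2))) =
        fun z => (D z).toReal +
          (D z).toReal * labelLoss (g z.1) z.2 * (Real.exp (-a) - 1) := by
      funext z
      by_cases hz : g z.1 = z.2
      · simp [labelLoss, hz]
      · simp only [labelLoss, hz, if_false]
        ring_nf
    rw [hpt]
    exact hD.add (hR.mul_right (Real.exp (-a) - 1))
  have hconv : Real.exp (-(a * risk D g)) ≤ 1 + risk D g * (Real.exp (-a) - 1) := by
    have := convexOn_exp.2 (Set.mem_univ 0) (Set.mem_univ (-a))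
      (sub_nonneg.2 (risk_mem D g).2) (risk_mem D g).1 (by ring)
    simp only [smul_eq_mul, mul_zero, zero_add, Real.exp_zero, mul_one] at this
    calc Real.exp (-(a * risk D g)) = Real.exp (risk D g * -a) := by ring_nf
      _ ≤ _ := this
      _ = _ := by ring
  calc expENN (-(a * risk D g))
      ≤ ENNReal.ofReal (∑' z, (D z).toReal * Real.exp (-(a * labelLoss (g z.1) z.2))) := by
        rw [hS.tsum_eq]; exact ENNReal.ofReal_le_ofReal hconv
    _ = ∑' z, D z * expENN (-(a * labelLoss (g z.1) z.2)) := by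
        rw [ENNReal.ofReal_tsum_of_nonneg (fun z => by positivity) hS.summable]
        refine tsum_congr fun z => ?_
        rw [ENNReal.ofReal_mul ENNReal.toReal_nonneg, ENNReal.ofReal_toReal (D.apply_ne_top z)]
        rfl

/-! ### Uniform convergence along adaptive samples -/

section Deviation

variable {X : Type u} {Y : Type v}

/-- The expectation, over `n` further rounds after the record `r`, of the supremum over all `g` of
`f g * exp (a * S g)`, where `S g` is the sum over these rounds of the loss of `g` on the sampled
example minus the risk of `g`. In a round with record `r` the hypothesis is drawn from `P` at the
examples in `r`, and the example from `A r`. -/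
noncomputable def deviationValue (a : ℝ) (P : List (X × Y) → PMF (X → Y))
    (A : List ((X → Y) × (X × Y)) → PMF (X × Y)) :
    ℕ → List ((X → Y) × (X × Y)) → ((X → Y) → ℝ≥0∞) → ℝ≥0∞
  | 0, _, f => ⨆ g, f g
  | n + 1, r, f => ∑' h, P (r.map Prod.snd) h * ∑' z, A r z *
      deviationValue a P A n ((h, z) :: r)
        (fun g => f g * expENN (a * (labelLoss (g z.1) z.2 - risk (A r) g)))

variable (a : ℝ) (P : List (X × Y) → PMF (X → Y)) (A : List ((X → Y) × (X × Y)) → PMF (X × Y))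

theorem deviationValue_mono (n : ℕ) (r : List ((X → Y) × (X × Y))) {f f' : (X → Y) → ℝ≥0∞}
    (h : ∀ g, f g ≤ f' g) : deviationValue a P A n r f ≤ deviationValue a P A n r f' := by
  induction n generalizing r f f' with
  | zero => exact iSup_mono h
  | succ n ih =>
    refine ENNReal.tsum_le_tsum fun h' => mul_le_mul_right (ENNReal.tsum_le_tsum fun z =>
      mul_le_mul_right (ih _ fun g => mul_le_mul_left (h g) _) _) _

theorem deviationValue_tsum_le (n : ℕ) (r : List ((X → Y) × (X × Y))) {ι : Type*}
    (f : ι → (X → Y) → ℝ≥0∞) :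
    deviationValue a P A n r (fun g => ∑' i, f i g) ≤ ∑' i, deviationValue a P A n r (f i) := by
  induction n generalizing r f with
  | zero => exact iSup_le fun g => ENNReal.tsum_le_tsum fun i => le_iSup (f i) g
  | succ n ih =>
    simp only [deviationValue]
    rw [ENNReal.tsum_comm]
    refine ENNReal.tsum_le_tsum fun h => ?_
    rw [ENNReal.tsum_mul_left, ENNReal.tsum_comm]
    refine mul_le_mul_right (ENNReal.tsum_le_tsum fun z => ?_) _
    rw [ENNReal.tsum_mul_left]
    refine mul_le_mul_right ?_ _
    simp only [← ENNReal.tsum_mul_right]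
    exact ih _ _

theorem deviationValue_const_mul (n : ℕ) (r : List ((X → Y) × (X × Y))) (c : ℝ≥0∞)
    (f : (X → Y) → ℝ≥0∞) :
    deviationValue a P A n r (fun g => c * f g) = c * deviationValue a P A n r f := by
  induction n generalizing r f with
  | zero => simp only [deviationValue, ENNReal.mul_iSup]
  | succ n ih =>
    simp only [deviationValue, mul_assoc, ih, ← ENNReal.tsum_mul_left]
    refine tsum_congr fun h => tsum_congr fun z => ?_
    ring

/-- The deviation on an example and an independent ghost example, for the class `V` and labels
`y`, `y'` of the two examples, with the version spaces counted by their Sauer number. -/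
noncomputable def ghostSum [Fintype Y] (n : ℕ) (V : Set (X → Y)) (z z' : X × Y) : ℝ≥0∞ :=
  ∑ y, ∑ y', expENN (a * (labelLoss y z.2 - labelLoss y' z'.2)) *
    sauerBound n (fiber (fiber V z.1 y) z'.1 y')

/-- Exchanging the example and the ghost example turns the exponential into a hyperbolic cosine,
uniformly over all labels. -/
theorem ghostSum_add_swap_le [Fintype Y] (n : ℕ) (V : Set (X → Y)) (z z' : X × Y) :
    ghostSum a n V z z' + ghostSum a n V z' z ≤
      2 * (ENNReal.ofReal (Real.cosh a) * sauerBound (n + 2) V) := by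
  have hswap : ghostSum a n V z' z = ∑ y, ∑ y',
      expENN (-(a * (labelLoss y z.2 - labelLoss y' z'.2))) *
        sauerBound n (fiber (fiber V z.1 y) z'.1 y') := by
    rw [ghostSum, Finset.sum_comm]
    refine Finset.sum_congr rfl fun y _ => Finset.sum_congr rfl fun y' _ => ?_
    rw [fiber_comm]
    ring_nf
  have hexp : ∀ y y', expENN (a * (labelLoss y z.2 - labelLoss y' z'.2)) +
      expENN (-(a * (labelLoss y z.2 - labelLoss y' z'.2))) ≤
        2 * ENNReal.ofReal (Real.cosh a) := by
    intro y y'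
    rw [expENN, expENN, ← ENNReal.ofReal_add (Real.exp_nonneg _) (Real.exp_nonneg _),
      ← ENNReal.ofReal_ofNat 2, ← ENNReal.ofReal_mul (by norm_num)]
    refine ENNReal.ofReal_le_ofReal ?_
    have hc : Real.cosh (a * (labelLoss y z.2 - labelLoss y' z'.2)) ≤ Real.cosh a := by
      rw [Real.cosh_le_cosh, abs_mul]
      refine mul_le_of_le_one_right (abs_nonneg a) (abs_le.2 ⟨?_, ?_⟩) <;>
        linarith [labelLoss_nonneg y z.2, labelLoss_nonneg y' z'.2, labelLoss_le_one y z.2,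
          labelLoss_le_one y' z'.2]
    rw [Real.cosh_eq] at hc
    linarith
  rw [hswap, ghostSum, ← Finset.sum_add_distrib, ← mul_assoc]
  simp only [← Finset.sum_add_distrib, ← add_mul]
  calc _ ≤ ∑ y, ∑ y', 2 * ENNReal.ofReal (Real.cosh a) *
        sauerBound n (fiber (fiber V z.1 y) z'.1 y') :=
        Finset.sum_le_sum fun y _ => Finset.sum_le_sum fun y' _ => mul_le_mul_left (hexp y y') _
    _ = 2 * ENNReal.ofReal (Real.cosh a) *
        ∑ y, ∑ y', sauerBound n (fiber (fiber V z.1 y) z'.1 y') := by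
        simp only [Finset.mul_sum]
    _ ≤ _ := by
        refine mul_le_mul_right ?_ _
        exact (Finset.sum_le_sum fun y _ => sum_sauerBound_fiber_le n (fiber V z.1 y) z'.1).trans
          (sum_sauerBound_fiber_le (n + 1) V z.1)

/-- Symmetrization: the example and the ghost example have the same law. -/
theorem tsum_ghostSum_le [Fintype Y] (D : PMF (X × Y)) (n : ℕ) (V : Set (X → Y)) :
    ∑' z, D z * ∑' z', D z' * ghostSum a n V z z' ≤
      ENNReal.ofReal (Real.cosh a) * sauerBound (n + 2) V := by
  have hconst : ∀ c : ℝ≥0∞, ∑' z, D z * ∑' z', D z' * c = c := fun c => by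
    simp only [ENNReal.tsum_mul_right, D.tsum_coe, one_mul]
  have hswap : ∑' z, D z * ∑' z', D z' * ghostSum a n V z z' =
      ∑' z, D z * ∑' z', D z' * ghostSum a n V z' z := by
    simp only [← ENNReal.tsum_mul_left]
    rw [ENNReal.tsum_comm]
    refine tsum_congr fun z => tsum_congr fun z' => ?_
    ring
  refine (ENNReal.mul_le_mul_iff_right (a := 2) (by norm_num) (by norm_num)).1 ?_
  calc 2 * ∑' z, D z * ∑' z', D z' * ghostSum a n V z z'
      = ∑' z, D z * ∑' z', D z' * (ghostSum a n V z z' + ghostSum a n V z' z) := by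
        rw [two_mul]
        nth_rewrite 2 [hswap]
        simp only [mul_add, ENNReal.tsum_add]
    _ ≤ ∑' z, D z * ∑' z', D z' * (2 * (ENNReal.ofReal (Real.cosh a) * sauerBound (n + 2) V)) :=
        ENNReal.tsum_le_tsum fun z => mul_le_mul_right (ENNReal.tsum_le_tsum fun z' =>
          mul_le_mul_right (ghostSum_add_swap_le a n V z z') _) _
    _ = _ := hconst _

/-- Uniform convergence: the exponential moment of the supremum over `V` of the deviations grows
with the number of rounds as for a single hypothesis, up to a Sauer number. -/
theorem deviationValue_indicator_le [Finite Y] (n : ℕ) (r : List ((X → Y) × (X × Y)))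
    (V : Set (X → Y)) :
    deviationValue a P A n r (V.indicator 1) ≤
      ENNReal.ofReal (Real.cosh a) ^ n * sauerBound (2 * n) V := by
  classical
  have := Fintype.ofFinite Y
  induction n generalizing r V with
  | zero =>
    rw [pow_zero, one_mul]
    refine iSup_le fun g => ?_
    by_cases hg : g ∈ V
    · simpa [hg] using one_le_sauerBound_zero ⟨g, hg⟩
    · simp [hg]
  | succ n ih =>
    set C := ENNReal.ofReal (Real.cosh a)
    have key : ∀ h z, deviationValue a P A n ((h, z) :: r) (fun g => V.indicator 1 g *
        expENN (a * (labelLoss (g z.1) z.2 - risk (A r) g))) ≤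
          ∑' z', A r z' * (C ^ n * ghostSum a (2 * n) V z z') := by
      intro h z
      -- The risk is replaced by the loss on a ghost example, and `V` is split by the labels of
      -- the two examples, on which alone the losses depend.
      calc deviationValue a P A n ((h, z) :: r) (fun g => V.indicator 1 g *
            expENN (a * (labelLoss (g z.1) z.2 - risk (A r) g)))
          ≤ deviationValue a P A n ((h, z) :: r) (fun g => ∑' z', A r z' *
              ∑' p : Y × Y, expENN (a * (labelLoss p.1 z.2 - labelLoss p.2 z'.2)) *
                (fiber (fiber V z.1 p.1) z'.1 p.2).indicator 1 g) := by
            refine deviationValue_mono a P A n _ fun g => ?_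
            by_cases hg : g ∈ V
            · have hp : ∀ z' : X × Y,
                  expENN (a * (labelLoss (g z.1) z.2 - labelLoss (g z'.1) z'.2)) ≤
                  ∑' p : Y × Y, expENN (a * (labelLoss p.1 z.2 - labelLoss p.2 z'.2)) *
                    (fiber (fiber V z.1 p.1) z'.1 p.2).indicator 1 g := fun z' => by
                refine le_trans ?_ (ENNReal.le_tsum (g z.1, g z'.1))
                simp [fiber, hg]
              refine le_trans ?_ (ENNReal.tsum_le_tsum fun z' => mul_le_mul_right (hp z') _)
              simp only [expENN_mul_sub, Set.indicator_of_mem hg, Pi.one_apply, one_mul,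
                mul_left_comm _ (expENN (a * labelLoss (g z.1) z.2))]
              rw [ENNReal.tsum_mul_left]
              exact mul_le_mul_right (expENN_neg_risk_le a (A r) g) _
            · simp [hg]
        _ ≤ ∑' z', A r z' * ∑' p : Y × Y,
              expENN (a * (labelLoss p.1 z.2 - labelLoss p.2 z'.2)) *
              deviationValue a P A n ((h, z) :: r)
                ((fiber (fiber V z.1 p.1) z'.1 p.2).indicator 1) := by
            refine (deviationValue_tsum_le a P A n _ _).trans (ENNReal.tsum_le_tsum fun z' => ?_)
            rw [deviationValue_const_mul]
            refine mul_le_mul_right ((deviationValue_tsum_le a P A n _ _).trans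
              (ENNReal.tsum_le_tsum fun p => ?_)) _
            rw [deviationValue_const_mul]
        _ ≤ ∑' z', A r z' * (C ^ n * ghostSum a (2 * n) V z z') := by
            refine ENNReal.tsum_le_tsum fun z' => mul_le_mul_right ?_ _
            rw [tsum_fintype, Fintype.sum_prod_type, ghostSum, Finset.mul_sum]
            refine Finset.sum_le_sum fun y _ => ?_
            rw [Finset.mul_sum]
            refine Finset.sum_le_sum fun y' _ => ?_
            rw [mul_left_comm]
            exact mul_le_mul_right (ih _ _) _
    calc deviationValue a P A (n + 1) r (V.indicator 1)
        ≤ ∑' h, P (r.map Prod.snd) h * ∑' z, A r z *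
            ∑' z', A r z' * (C ^ n * ghostSum a (2 * n) V z z') :=
          ENNReal.tsum_le_tsum fun h => mul_le_mul_right (ENNReal.tsum_le_tsum fun z =>
            mul_le_mul_right (key h z) _) _
      _ = C ^ n * ∑' z, A r z * ∑' z', A r z' * ghostSum a (2 * n) V z z' := by
          rw [ENNReal.tsum_mul_right, (P _).tsum_coe, one_mul]
          simp only [mul_left_comm _ (C ^ n), ENNReal.tsum_mul_left]
      _ ≤ C ^ n * (C * sauerBound (2 * n + 2) V) :=
          mul_le_mul_right (tsum_ghostSum_le a (A r) (2 * n) V) _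
      _ = C ^ (n + 1) * sauerBound (2 * (n + 1)) V := by rw [pow_succ, mul_assoc]; rfl

end Deviation

/-! ### Learners that measure the examples in the computational basis -/

section ClassicalLearner

variable {X : Type u} {Y : Type v}

/-- Multiplication by the square root of a probability. -/
noncomputable def scaleOp (q : ℝ≥0∞) : StateSpace PUnit →L[ℂ] StateSpace PUnit :=
  ((Real.sqrt q.toReal : ℝ) : ℂ) • ContinuousLinearMap.id ℂ _

theorem norm_sq_scaleOp (q : ℝ≥0∞) (φ : StateSpace PUnit) :
    ‖scaleOp q φ‖ ^ 2 = q.toReal * ‖φ‖ ^ 2 := by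
  have h : scaleOp q φ = ((Real.sqrt q.toReal : ℝ) : ℂ) • φ := rfl
  rw [h, norm_smul, mul_pow, Complex.norm_real, Real.norm_eq_abs, sq_abs,
    Real.sq_sqrt ENNReal.toReal_nonneg]

/-- The operator `⟨z|` on the example, which reads its basis state `z`. -/
noncomputable def readOp {Z : Type*} (z : Z) : StateSpace (PUnit × Z) →L[ℂ] StateSpace PUnit :=
  (lp.singleContinuousLinearMap ℂ (fun _ : PUnit => ℂ) 2 PUnit.unit).comp
    (lp.evalCLM ℂ (fun _ : PUnit × Z => ℂ) 2 (PUnit.unit, z))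

theorem norm_readOp {Z : Type*} (z : Z) (φ : StateSpace (PUnit × Z)) :
    ‖readOp z φ‖ = ‖φ (PUnit.unit, z)‖ := by
  have h : readOp z φ = lp.single 2 PUnit.unit (φ (PUnit.unit, z)) := rfl
  rw [h, lp.norm_single (by norm_num)]

theorem norm_sq_readOp_tensor {Z : Type*} (z : Z) (D : PMF Z) (q : ℝ≥0∞) (φ : StateSpace PUnit) :
    ‖readOp z ((scaleOp q φ).tensor (quantumExample D))‖ ^ 2 =
      q.toReal * ‖φ‖ ^ 2 * (D z).toReal := by
  have hex : ‖quantumExample D z‖ ^ 2 = (D z).toReal := by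
    have h : quantumExample D z = ((Real.sqrt (D z).toReal : ℝ) : ℂ) := rfl
    rw [h, Complex.norm_real, Real.norm_eq_abs, sq_abs, Real.sq_sqrt ENNReal.toReal_nonneg]
  have hmem : ‖scaleOp q φ PUnit.unit‖ ^ 2 = ‖scaleOp q φ‖ ^ 2 :=
    (hasSum_unique _).unique (scaleOp q φ).hasSum_norm_sq
  have htensor : (scaleOp q φ).tensor (quantumExample D) (PUnit.unit, z) =
      scaleOp q φ PUnit.unit * quantumExample D z := rfl
  rw [norm_readOp, htensor, norm_mul, mul_pow, hex, hmem, norm_sq_scaleOp]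

/-- A learner with a trivial memory `ℓ²(PUnit)`: it measures each example in the computational
basis, records the outcome, an element of `X × Y`, and draws its next hypothesis from the
distribution `P` at the list of the outcomes so far, the most recent one first. -/
noncomputable def classicalLearner (P : List (X × Y) → PMF (X → Y)) : QuantumLearner X Y where
  Mem := PUnit
  Out := X × Y
  init := lp.single 2 PUnit.unit 1
  norm_init := by rw [lp.norm_single (by norm_num)]; simp
  predict r :=
    { op := fun h => scaleOp (P (r.map Prod.snd) h)
      complete := fun φ => by
        have h := (P (r.map Prod.snd)).hasSum_toReal.mul_right (‖φ‖ ^ 2)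
        rw [one_mul] at h
        simpa only [norm_sq_scaleOp] using h }
  update _ _ :=
    { op := readOp
      complete := fun φ => by
        have h := φ.hasSum_norm_sq
        rw [← (Equiv.punitProd (X × Y)).symm.hasSum_iff] at h
        simp only [norm_readOp]
        exact h }

/-- The probability of a record, as a product over its rounds. -/
noncomputable def recordWeight (P : List (X × Y) → PMF (X → Y))
    (A : List ((X → Y) × (X × Y)) → PMF (X × Y)) : List ((X → Y) × (X × Y)) → ℝ≥0∞
  | [] => 1
  | (h, z) :: r => recordWeight P A r * (P (r.map Prod.snd) h * A r z)

/-- The conditional expectation of `F` after one more round. -/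
noncomputable def nextRound (P : List (X × Y) → PMF (X → Y))
    (A : List ((X → Y) × (X × Y)) → PMF (X × Y)) (F : List ((X → Y) × (X × Y)) → ℝ≥0∞)
    (r : List ((X → Y) × (X × Y))) : ℝ≥0∞ :=
  ∑' h, P (r.map Prod.snd) h * ∑' z, A r z * F ((h, z) :: r)

/-- The expectation of `F` over the records of `T` rounds. -/
noncomputable def recordExpectation (P : List (X × Y) → PMF (X → Y))
    (A : List ((X → Y) × (X × Y)) → PMF (X × Y)) (T : ℕ)
    (F : List ((X → Y) × (X × Y)) → ℝ≥0∞) : ℝ≥0∞ :=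
  ∑' r : List.Vector ((X → Y) × (X × Y)) T, recordWeight P A r.toList * F r.toList

variable (P : List (X × Y) → PMF (X → Y))

theorem norm_sq_state_classicalLearner (A : Adversary (classicalLearner P))
    (r : List ((X → Y) × (X × Y))) :
    ‖(classicalLearner P).state A r‖ ^ 2 = (recordWeight P A r).toReal := by
  induction r with
  | nil =>
    have h : ‖(classicalLearner P).state A []‖ = 1 := (classicalLearner P).norm_init
    calc _ = (1 : ℝ) ^ 2 := congrArg (· ^ 2) h
      _ = _ := by simp [recordWeight]
  | cons a r ih =>
    obtain ⟨h, z⟩ := a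
    calc ‖(classicalLearner P).state A ((h, z) :: r)‖ ^ 2
        = (P (r.map Prod.snd) h).toReal * ‖(classicalLearner P).state A r‖ ^ 2 * (A r z).toReal :=
          norm_sq_readOp_tensor z (A r) (P (r.map Prod.snd) h) ((classicalLearner P).state A r)
      _ = (P (r.map Prod.snd) h).toReal * (recordWeight P A r).toReal * (A r z).toReal :=
          congrArg (fun x => _ * x * _) ih
      _ = (recordWeight P A ((h, z) :: r)).toReal := by
          simp only [recordWeight, ENNReal.toReal_mul]
          ring

theorem law_classicalLearner (A : Adversary (classicalLearner P)) (T : ℕ)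
    (r : List.Vector ((X → Y) × (X × Y)) T) :
    (classicalLearner P).law A T r = recordWeight P A r.toList := by
  have hfin : recordWeight P A r.toList ≠ ∞ := by
    induction r.toList with
    | nil => exact ENNReal.one_ne_top
    | cons a l ih =>
      exact ENNReal.mul_ne_top ih (ENNReal.mul_ne_top (PMF.apply_ne_top _ _)
        (PMF.apply_ne_top _ _))
  calc (classicalLearner P).law A T r
      = ENNReal.ofReal (‖(classicalLearner P).state A r.toList‖ ^ 2) := rfl
    _ = ENNReal.ofReal (recordWeight P A r.toList).toReal :=
        congrArg ENNReal.ofReal (norm_sq_state_classicalLearner P A r.toList)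
    _ = recordWeight P A r.toList := ENNReal.ofReal_toReal hfin

variable (A : List ((X → Y) × (X × Y)) → PMF (X × Y))

theorem recordExpectation_succ (T : ℕ) (F : List ((X → Y) × (X × Y)) → ℝ≥0∞) :
    recordExpectation P A (T + 1) F = recordExpectation P A T (nextRound P A F) := by
  let e : ((X → Y) × (X × Y)) × List.Vector ((X → Y) × (X × Y)) T ≃
      List.Vector ((X → Y) × (X × Y)) (T + 1) :=
    { toFun := fun p => p.1 ::ᵥ p.2
      invFun := fun r => (r.head, r.tail)
      left_inv := fun p => by simp
      right_inv := fun r => by simp }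
  rw [recordExpectation, ← e.tsum_eq, ENNReal.tsum_prod', ENNReal.tsum_comm]
  refine tsum_congr fun r => ?_
  rw [ENNReal.tsum_prod', nextRound, ← ENNReal.tsum_mul_left]
  refine tsum_congr fun h => ?_
  rw [← mul_assoc, ← ENNReal.tsum_mul_left]
  refine tsum_congr fun z => ?_
  simp only [e, Equiv.coe_fn_mk, List.Vector.toList_cons, recordWeight]
  ring

theorem recordExpectation_add (T : ℕ) (F G : List ((X → Y) × (X × Y)) → ℝ≥0∞) :
    recordExpectation P A T (fun r => F r + G r) =
      recordExpectation P A T F + recordExpectation P A T G := by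
  simp only [recordExpectation, mul_add, ENNReal.tsum_add]

theorem recordExpectation_one (T : ℕ) : recordExpectation P A T (fun _ => 1) = 1 := by
  induction T with
  | zero =>
    rw [recordExpectation, tsum_eq_single List.Vector.nil
      (fun r hr => absurd (Subsingleton.elim _ _) hr)]
    simp [recordWeight]
  | succ T ih =>
    have h : nextRound P A (fun _ => 1) = fun _ => 1 := by
      funext r
      simp only [nextRound, mul_one, PMF.tsum_coe]
    rw [recordExpectation_succ, h, ih]

theorem recordExpectation_eq_iterate (T : ℕ) (F : List ((X → Y) × (X × Y)) → ℝ≥0∞) :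
    recordExpectation P A T F = (nextRound P A)^[T] F [] := by
  induction T generalizing F with
  | zero =>
    rw [recordExpectation, tsum_eq_single List.Vector.nil
      (fun r hr => absurd (Subsingleton.elim _ _) hr)]
    simp [recordWeight]
  | succ T ih => rw [recordExpectation_succ, ih, Function.iterate_succ_apply]

/-- The number of mistakes of `g` on a list of examples. -/
noncomputable def sampleLoss (g : X → Y) : List (X × Y) → ℝ
  | [] => 0
  | z :: zs => labelLoss (g z.1) z.2 + sampleLoss g zs

/-- The sum of the risks of `g` over the rounds of a record. -/
noncomputable def totalRisk (g : X → Y) : List ((X → Y) × (X × Y)) → ℝ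
  | [] => 0
  | _ :: r => risk (A r) g + totalRisk g r

/-- The exponential moment of the largest deviation over `V`. -/
theorem recordExpectation_deviation_le [Finite Y] (a : ℝ) (T : ℕ) (V : Set (X → Y)) :
    recordExpectation P A T (fun r => ⨆ g, V.indicator 1 g *
        expENN (a * (sampleLoss g (r.map Prod.snd) - totalRisk A g r))) ≤
      ENNReal.ofReal (Real.cosh a) ^ T * sauerBound (2 * T) V := by
  have key : ∀ n r, (nextRound P A)^[n] (fun r => ⨆ g, V.indicator 1 g *
        expENN (a * (sampleLoss g (r.map Prod.snd) - totalRisk A g r))) r =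
      deviationValue a P A n r (fun g => V.indicator 1 g *
        expENN (a * (sampleLoss g (r.map Prod.snd) - totalRisk A g r))) := by
    intro n
    induction n with
    | zero => intro r; rfl
    | succ n ih =>
      intro r
      rw [Function.iterate_succ_apply']
      refine tsum_congr fun h => congrArg _ (tsum_congr fun z => congrArg _ ?_)
      rw [ih]
      congr 1
      funext g
      rw [mul_assoc, ← expENN_add]
      simp only [List.map_cons, sampleLoss, totalRisk]
      ring_nf
  rw [recordExpectation_eq_iterate, key]
  simpa [sampleLoss, totalRisk, expENN_zero] using deviationValue_indicator_le a P A T [] V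

/-- The probability that a hypothesis drawn from `p` errs on `z`. -/
noncomputable def mixtureLoss (p : PMF (X → Y)) (z : X × Y) : ℝ :=
  (∑' h, p h * ENNReal.ofReal (labelLoss (h z.1) z.2)).toReal

theorem tsum_mul_labelLoss_le (p : PMF (X → Y)) (z : X × Y) :
    ∑' h, p h * ENNReal.ofReal (labelLoss (h z.1) z.2) ≤ 1 := by
  rw [← p.tsum_coe]
  exact ENNReal.tsum_le_tsum fun h =>
    mul_le_of_le_one_right' (ENNReal.ofReal_le_one.2 (labelLoss_le_one _ _))

theorem ofReal_mixtureLoss (p : PMF (X → Y)) (z : X × Y) :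
    ENNReal.ofReal (mixtureLoss p z) = ∑' h, p h * ENNReal.ofReal (labelLoss (h z.1) z.2) :=
  ENNReal.ofReal_toReal (ne_top_of_le_ne_top ENNReal.one_ne_top (tsum_mul_labelLoss_le p z))

theorem mixtureLoss_nonneg (p : PMF (X → Y)) (z : X × Y) : 0 ≤ mixtureLoss p z :=
  ENNReal.toReal_nonneg

theorem mixtureLoss_le_one (p : PMF (X → Y)) (z : X × Y) : mixtureLoss p z ≤ 1 :=
  ENNReal.toReal_le_of_le_ofReal zero_le_one (by simpa using tsum_mul_labelLoss_le p z)

/-- The expected number of mistakes, over the draws of the hypotheses, on a list of examples. -/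
noncomputable def totalMixtureLoss : List (X × Y) → ℝ
  | [] => 0
  | z :: zs => mixtureLoss (P zs) z + totalMixtureLoss zs

theorem totalMixtureLoss_mem (zs : List (X × Y)) :
    0 ≤ totalMixtureLoss P zs ∧ totalMixtureLoss P zs ≤ zs.length := by
  induction zs with
  | nil => simp [totalMixtureLoss]
  | cons z zs ih =>
    have h₀ := mixtureLoss_nonneg (P zs) z
    have h₁ := mixtureLoss_le_one (P zs) z
    simp only [totalMixtureLoss, List.length_cons, Nat.cast_add, Nat.cast_one]
    constructor <;> linarith

/-- The sum of the risks of the hypotheses played over the rounds of a record. -/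
noncomputable def playedRisk : List ((X → Y) × (X × Y)) → ℝ
  | [] => 0
  | (h, _) :: r => risk (A r) h + playedRisk r

theorem playedRisk_nonneg (r : List ((X → Y) × (X × Y))) : 0 ≤ playedRisk A r := by
  induction r with
  | nil => simp [playedRisk]
  | cons a r ih => exact add_nonneg (risk_mem _ _).1 ih

/-- The example of a round is independent of the hypothesis that is played, so that the risk may
be replaced by the mixture loss on the example. -/
theorem recordExpectation_playedRisk (T : ℕ) :
    recordExpectation P A T (fun r => ENNReal.ofReal (playedRisk A r)) =
      recordExpectation P A T
        (fun r => ENNReal.ofReal (totalMixtureLoss P (r.map Prod.snd))) := by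
  induction T with
  | zero =>
    simp only [recordExpectation_eq_iterate]
    rfl
  | succ T ih =>
    have hconst : ∀ (r : List ((X → Y) × (X × Y))) (c : ℝ≥0∞), ∑' z, A r z * c = c := fun r c => by
      rw [ENNReal.tsum_mul_right, PMF.tsum_coe, one_mul]
    have hconst' : ∀ (r : List ((X → Y) × (X × Y))) (c : ℝ≥0∞),
        ∑' h, P (r.map Prod.snd) h * c = c := fun r c => by
      rw [ENNReal.tsum_mul_right, PMF.tsum_coe, one_mul]
    have h₁ : nextRound P A (fun r => ENNReal.ofReal (playedRisk A r)) = fun r =>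
        (∑' h, P (r.map Prod.snd) h * ENNReal.ofReal (risk (A r) h)) +
          ENNReal.ofReal (playedRisk A r) := by
      funext r
      simp only [nextRound, playedRisk,
        ENNReal.ofReal_add (risk_mem _ _).1 (playedRisk_nonneg A r), hconst, mul_add,
        ENNReal.tsum_add, hconst']
    have h₂ : nextRound P A (fun r => ENNReal.ofReal (totalMixtureLoss P (r.map Prod.snd))) =
        fun r => (∑' h, P (r.map Prod.snd) h * ENNReal.ofReal (risk (A r) h)) +
          ENNReal.ofReal (totalMixtureLoss P (r.map Prod.snd)) := by
      funext r
      simp only [nextRound, List.map_cons, totalMixtureLoss,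
        ENNReal.ofReal_add (mixtureLoss_nonneg _ _) (totalMixtureLoss_mem P _).1, hconst, mul_add,
        ENNReal.tsum_add, hconst', ofReal_mixtureLoss, ofReal_risk]
      congr 1
      simp only [← ENNReal.tsum_mul_left]
      rw [ENNReal.tsum_comm]
      refine tsum_congr fun z => tsum_congr fun h => ?_
      ring
    rw [recordExpectation_succ, recordExpectation_succ, h₁, h₂, recordExpectation_add,
      recordExpectation_add, ih]

end ClassicalLearner

/-! ### Exponential weights over version spaces -/

section WeightedPMF

variable {α β : Type*}

open Classical in
theorem hasSum_list_sum_ite (l : List β) (f : β → α) (w : β → ℝ) (F : α → ℝ) :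
    HasSum (fun x => (l.map fun e => if x = f e then w e else 0).sum * F x)
      (l.map fun e => w e * F (f e)).sum := by
  induction l with
  | nil => simp
  | cons e l ih =>
    simp only [List.map_cons, List.sum_cons, add_mul]
    refine HasSum.add ?_ ih
    have hpt : (fun x => (if x = f e then w e else 0) * F x) =
        fun x => if x = f e then w e * F (f e) else 0 := by
      funext x
      split_ifs with hx
      · rw [hx]
      · exact zero_mul _
    rw [hpt]
    exact hasSum_ite_eq (f e) (w e * F (f e))

open Classical in
/-- The law of `f e` when `e` is drawn from the list `l` with probability proportional to the
weight `w e`. -/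
noncomputable def weightedPMF (l : List β) (f : β → α) (w : β → ℝ) (hw : ∀ e ∈ l, 0 ≤ w e)
    (hpos : 0 < (l.map w).sum) : PMF α :=
  ⟨fun x => ENNReal.ofReal ((l.map fun e => if x = f e then w e else 0).sum * (l.map w).sum⁻¹), by
    have h := hasSum_list_sum_ite l f w (fun _ => (l.map w).sum⁻¹)
    rw [List.sum_map_mul_right, mul_inv_cancel₀ hpos.ne'] at h
    have h' := ENNReal.ofReal_tsum_of_nonneg (fun x => mul_nonneg (List.sum_nonneg (by
      simp only [List.mem_map, forall_exists_index, and_imp, forall_apply_eq_imp_iff₂]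
      intro e he
      split_ifs
      exacts [hw e he, le_rfl])) (inv_nonneg.2 hpos.le)) h.summable
    rw [h.tsum_eq, ENNReal.ofReal_one] at h'
    rw [h']
    exact ENNReal.summable.hasSum⟩

theorem tsum_weightedPMF_mul (l : List β) (f : β → α) (w : β → ℝ) (hw : ∀ e ∈ l, 0 ≤ w e)
    (hpos : 0 < (l.map w).sum) (F : α → ℝ) (hF : ∀ x, 0 ≤ F x) :
    ∑' x, weightedPMF l f w hw hpos x * ENNReal.ofReal (F x) =
      ENNReal.ofReal ((l.map fun e => w e * F (f e)).sum / (l.map w).sum) := by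
  classical
  have hnn : ∀ x, 0 ≤ (l.map fun e => if x = f e then w e else 0).sum := fun x =>
    List.sum_nonneg (by
      simp only [List.mem_map, forall_exists_index, and_imp, forall_apply_eq_imp_iff₂]
      intro e he
      split_ifs
      exacts [hw e he, le_rfl])
  have h := (hasSum_list_sum_ite l f w F).mul_right (l.map w).sum⁻¹
  rw [div_eq_mul_inv, ← h.tsum_eq, ENNReal.ofReal_tsum_of_nonneg
    (fun x => mul_nonneg (mul_nonneg (hnn x) (hF x)) (inv_nonneg.2 hpos.le)) h.summable]
  refine tsum_congr fun x => ?_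
  rw [mul_right_comm, ENNReal.ofReal_mul (mul_nonneg (hnn x) (inv_nonneg.2 hpos.le))]
  simp only [weightedPMF]
  congr

end WeightedPMF

section Hedge

variable {X : Type u} {Y : Type v} [Fintype Y] [Nonempty Y]

/-- The hypotheses proposed by a weighted version space: the prediction of the standard optimal
algorithm, with the weight of the version space, and each constant label, with the weight scaled
by `b`. The entries keep the version space. -/
noncomputable def proposals (b : ℝ) (l : List (Set (X → Y) × ℝ)) :
    List (Set (X → Y) × (X → Y) × ℝ) :=
  l.flatMap fun c => (c.1, soa c.1, c.2) ::
    (Finset.univ : Finset Y).toList.map fun y => (c.1, fun _ => y, b * c.2)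

/-- The weighted version spaces after a list of examples: each proposal restricts its version
space to the hypotheses that agree with it on the new example, and its weight is multiplied by
`exp (-a)` if it errs there. -/
noncomputable def cells (a b : ℝ) (H : Set (X → Y)) : List (X × Y) → List (Set (X → Y) × ℝ)
  | [] => [(H, 1)]
  | z :: zs => (proposals b (cells a b H zs)).map fun e =>
      (fiber e.1 z.1 (e.2.1 z.1), e.2.2 * Real.exp (-(a * labelLoss (e.2.1 z.1) z.2)))

theorem sum_proposals (b : ℝ) (l : List (Set (X → Y) × ℝ)) :
    ((proposals b l).map fun e => e.2.2).sum =
      (l.map Prod.snd).sum * (1 + Fintype.card Y * b) := by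
  induction l with
  | nil => simp [proposals]
  | cons c l ih =>
    have h : proposals b (c :: l) = ((c.1, soa c.1, c.2) ::
      (Finset.univ : Finset Y).toList.map fun y => (c.1, fun _ => y, b * c.2)) ++
        proposals b l := rfl
    rw [h, List.map_append, List.sum_append, ih]
    simp only [List.map_cons, List.sum_cons, List.map_map, Function.comp_def, List.map_const',
      List.sum_replicate, Finset.length_toList, Finset.card_univ, nsmul_eq_mul]
    ring

theorem proposals_pos {b : ℝ} (hb : 0 < b) {l : List (Set (X → Y) × ℝ)}
    (hl : ∀ c ∈ l, 0 < c.2) : ∀ e ∈ proposals b l, 0 < e.2.2 := by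
  intro e he
  simp only [proposals, List.mem_flatMap, List.mem_cons, List.mem_map, Finset.mem_toList,
    Finset.mem_univ, true_and] at he
  obtain ⟨c, hc, rfl | ⟨y, rfl⟩⟩ := he
  exacts [hl c hc, mul_pos hb (hl c hc)]

theorem cells_pos (a : ℝ) {b : ℝ} (hb : 0 < b) (H : Set (X → Y)) (zs : List (X × Y)) :
    ∀ c ∈ cells a b H zs, 0 < c.2 := by
  induction zs with
  | nil => simp [cells]
  | cons z zs ih =>
    intro c hc
    obtain ⟨e, he, rfl⟩ := List.mem_map.1 hc
    exact mul_pos (proposals_pos hb ih e he) (Real.exp_pos _)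

theorem sum_cells_pos (a : ℝ) {b : ℝ} (hb : 0 < b) (H : Set (X → Y)) (zs : List (X × Y)) :
    0 < ((cells a b H zs).map Prod.snd).sum := by
  refine List.sum_pos _ (by
    intro x hx
    obtain ⟨c, hc, rfl⟩ := List.mem_map.1 hx
    exact cells_pos a hb H zs c hc) ?_
  induction zs with
  | nil => simp [cells]
  | cons z zs ih =>
    have hne : cells a b H zs ≠ [] := fun h => ih (by rw [h]; rfl)
    obtain ⟨c, hc⟩ := List.exists_mem_of_ne_nil _ hne
    simp only [cells, proposals, ne_eq, List.map_eq_nil_iff, List.flatMap_eq_nil_iff]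
    exact fun h => List.cons_ne_nil _ _ (h c hc)

theorem sum_proposals_cells_pos (a : ℝ) {b : ℝ} (hb : 0 < b) (H : Set (X → Y))
    (zs : List (X × Y)) : 0 < ((proposals b (cells a b H zs)).map fun e => e.2.2).sum := by
  rw [sum_proposals]
  exact mul_pos (sum_cells_pos a hb H zs) (by positivity)

/-- The exponential weights algorithm with learning rate `a`: the next hypothesis is a proposal
drawn with probability proportional to its weight. -/
noncomputable def hedge (a : ℝ) {b : ℝ} (hb : 0 < b) (H : Set (X → Y)) (zs : List (X × Y)) :
    PMF (X → Y) :=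
  weightedPMF (proposals b (cells a b H zs)) (fun e => e.2.1) (fun e => e.2.2)
    (fun e he => (proposals_pos hb (cells_pos a hb H zs) e he).le)
    (sum_proposals_cells_pos a hb H zs)

theorem mixtureLoss_hedge_mul (a : ℝ) {b : ℝ} (hb : 0 < b) (H : Set (X → Y)) (zs : List (X × Y))
    (z : X × Y) :
    mixtureLoss (hedge a hb H zs) z * ((proposals b (cells a b H zs)).map fun e => e.2.2).sum =
      ((proposals b (cells a b H zs)).map fun e => e.2.2 * labelLoss (e.2.1 z.1) z.2).sum := by
  have hpos := sum_proposals_cells_pos a hb H zs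
  have hsum : ∑' h, hedge a hb H zs h * ENNReal.ofReal (labelLoss (h z.1) z.2) = _ :=
    tsum_weightedPMF_mul _ _ _ _ hpos (fun h : X → Y => labelLoss (h z.1) z.2)
      (fun h => labelLoss_nonneg _ _)
  rw [mixtureLoss, hsum, ENNReal.toReal_ofReal, div_mul_cancel₀ _ hpos.ne']
  refine div_nonneg (List.sum_nonneg ?_) hpos.le
  simp only [List.mem_map, forall_exists_index, and_imp, forall_apply_eq_imp_iff₂]
  exact fun e he => mul_nonneg (proposals_pos hb (cells_pos a hb H zs) e he).le
    (labelLoss_nonneg _ _)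

/-- The total weight decreases exponentially in the mixture loss. -/
theorem sum_cells_le {a : ℝ} (ha : 0 ≤ a) {b : ℝ} (hb : 0 < b) (H : Set (X → Y))
    (zs : List (X × Y)) :
    ((cells a b H zs).map Prod.snd).sum ≤
      Real.exp (zs.length * (Fintype.card Y * b + a ^ 2) - a * totalMixtureLoss (hedge a hb H) zs)
    := by
  induction zs with
  | nil => simp [cells, totalMixtureLoss]
  | cons z zs ih =>
    set l := proposals b (cells a b H zs) with hl
    set q := mixtureLoss (hedge a hb H zs) z with hq
    have hmul := mixtureLoss_hedge_mul a hb H zs z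
    have hsum : ((cells a b H (z :: zs)).map Prod.snd).sum =
        (l.map fun e => e.2.2).sum * (1 - (1 - Real.exp (-a)) * q) := by
      have hpt : ∀ e : Set (X → Y) × (X → Y) × ℝ,
          e.2.2 * Real.exp (-(a * labelLoss (e.2.1 z.1) z.2)) =
            e.2.2 + e.2.2 * labelLoss (e.2.1 z.1) z.2 * (Real.exp (-a) - 1) := by
        intro e
        by_cases he : e.2.1 z.1 = z.2
        · simp [labelLoss, he]
        · simp only [labelLoss, he, if_false]
          ring_nf
      simp only [cells, List.map_map, Function.comp_def, hpt, ← hl, List.sum_map_add,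
        List.sum_map_mul_right]
      rw [← hmul]
      ring
    have hq₀ : 0 ≤ q := mixtureLoss_nonneg _ _
    have hq₁ : q ≤ 1 := mixtureLoss_le_one _ _
    -- `1 - exp (-a) ≥ a / (1 + a) ≥ a - a ^ 2`
    have hexp : a - a ^ 2 ≤ 1 - Real.exp (-a) := by
      have h₁ : Real.exp (-a) * (1 + a) ≤ 1 := by
        calc Real.exp (-a) * (1 + a) ≤ Real.exp (-a) * Real.exp a := by
              gcongr
              linarith [Real.add_one_le_exp a]
          _ = 1 := by rw [← Real.exp_add]; simp
      nlinarith [Real.exp_pos (-a), pow_nonneg ha 3]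
    have hdec : 1 - (1 - Real.exp (-a)) * q ≤ Real.exp (a ^ 2 - a * q) := by
      refine le_trans ?_ (Real.add_one_le_exp _)
      nlinarith [mul_le_mul_of_nonneg_right hexp hq₀, mul_nonneg (sq_nonneg a) (sub_nonneg.2 hq₁)]
    have hgrow : (1 : ℝ) + Fintype.card Y * b ≤ Real.exp (Fintype.card Y * b) := by
      linarith [Real.add_one_le_exp ((Fintype.card Y : ℝ) * b)]
    rw [hsum, hl, sum_proposals]
    calc ((cells a b H zs).map Prod.snd).sum * (1 + Fintype.card Y * b) *
          (1 - (1 - Real.exp (-a)) * q)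
        ≤ ((cells a b H zs).map Prod.snd).sum * (1 + Fintype.card Y * b) *
          Real.exp (a ^ 2 - a * q) :=
          mul_le_mul_of_nonneg_left hdec
            (mul_nonneg (sum_cells_pos a hb H zs).le (by positivity))
      _ ≤ Real.exp (zs.length * (Fintype.card Y * b + a ^ 2) -
            a * totalMixtureLoss (hedge a hb H) zs) * Real.exp (Fintype.card Y * b) *
          Real.exp (a ^ 2 - a * q) := by
          gcongr
      _ = _ := by
          rw [← Real.exp_add, ← Real.exp_add]
          congr 1
          simp only [List.length_cons, totalMixtureLoss, ← hq]
          push_cast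
          ring

/-- Each hypothesis of the class stays in a cell whose weight has been scaled by `b` at most once
for each time the dimension has dropped. -/
theorem exists_cell (a b : ℝ) (hb : 0 < b) {H : Set (X → Y)} {d : ℕ} (hH : ¬ Shatters (d + 1) H)
    {g : X → Y} (hg : g ∈ H) (zs : List (X × Y)) :
    ∃ c ∈ cells a b H zs, g ∈ c.1 ∧ ∃ m j : ℕ, ¬ Shatters m c.1 ∧ m + j ≤ d + 1 ∧
      b ^ j * Real.exp (-(a * sampleLoss g zs)) ≤ c.2 := by
  induction zs with
  | nil => exact ⟨(H, 1), by simp [cells], hg, d + 1, 0, hH, le_rfl, by simp [sampleLoss]⟩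
  | cons z zs ih =>
    obtain ⟨c, hc, hgc, m, j, hm, hmj, hw⟩ := ih
    have hsplit : Real.exp (-(a * sampleLoss g (z :: zs))) =
        Real.exp (-(a * sampleLoss g zs)) * Real.exp (-(a * labelLoss (g z.1) z.2)) := by
      rw [← Real.exp_add, sampleLoss]
      ring_nf
    by_cases hs : g z.1 = soa c.1 z.1
    · refine ⟨_, List.mem_map.2 ⟨(c.1, soa c.1, c.2), List.mem_flatMap.2 ⟨c, hc, by simp⟩, rfl⟩,
        ⟨hgc, hs⟩, m, j, fun h => hm (h.mono (fiber_subset _ _ _)), hmj, ?_⟩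
      simp only [← hs]
      rw [hsplit, ← mul_assoc]
      exact mul_le_mul_of_nonneg_right hw (Real.exp_nonneg _)
    · cases m with
      | zero => exact absurd (shatters_zero.2 ⟨g, hgc⟩) hm
      | succ m =>
        refine ⟨_, List.mem_map.2 ⟨(c.1, fun _ => g z.1, b * c.2),
          List.mem_flatMap.2 ⟨c, hc, by simp⟩, rfl⟩, ⟨hgc, rfl⟩, m, j + 1,
          not_shatters_fiber_of_ne_soa hm hs, by omega, ?_⟩
        rw [hsplit, ← mul_assoc, pow_succ']
        refine mul_le_mul_of_nonneg_right ?_ (Real.exp_nonneg _)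
        rw [mul_assoc]
        exact mul_le_mul_of_nonneg_left hw hb.le

/-- The regret bound of the exponential weights algorithm on a sequence of examples. -/
theorem mul_totalMixtureLoss_hedge_le {a : ℝ} (ha : 0 ≤ a) {b : ℝ} (hb : 0 < b) (hb₁ : b ≤ 1)
    {H : Set (X → Y)} {d : ℕ} (hH : ¬ Shatters (d + 1) H) {g : X → Y} (hg : g ∈ H)
    (zs : List (X × Y)) :
    a * totalMixtureLoss (hedge a hb H) zs ≤
      a * sampleLoss g zs + zs.length * (Fintype.card Y * b + a ^ 2) - d * Real.log b := by
  obtain ⟨c, hc, hgc, m, j, hm, hmj, hw⟩ := exists_cell a b hb hH hg zs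
  have hjd : j ≤ d := by
    cases m with
    | zero => exact absurd (shatters_zero.2 ⟨g, hgc⟩) hm
    | succ m => omega
  have hc_le : c.2 ≤ ((cells a b H zs).map Prod.snd).sum :=
    List.single_le_sum (by
      simp only [List.mem_map, forall_exists_index, and_imp, forall_apply_eq_imp_iff₂]
      exact fun e he => (cells_pos a hb H zs e he).le) _ (List.mem_map.2 ⟨c, hc, rfl⟩)
  have hexp : Real.exp (d * Real.log b - a * sampleLoss g zs) ≤
      Real.exp (zs.length * (Fintype.card Y * b + a ^ 2) -
        a * totalMixtureLoss (hedge a hb H) zs) := by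
    calc Real.exp (d * Real.log b - a * sampleLoss g zs)
        = b ^ d * Real.exp (-(a * sampleLoss g zs)) := by
          rw [sub_eq_add_neg, Real.exp_add, Real.exp_nat_mul, Real.exp_log hb]
      _ ≤ b ^ j * Real.exp (-(a * sampleLoss g zs)) :=
          mul_le_mul_of_nonneg_right (pow_le_pow_of_le_one hb.le hb₁ hjd) (Real.exp_nonneg _)
      _ ≤ _ := hw.trans (hc_le.trans (sum_cells_le ha hb H zs))
  linarith [Real.exp_le_exp.1 hexp]

end Hedge

/-! ### The expected regret -/

section Regret

variable {X : Type u} {Y : Type v}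

theorem learnerLoss_classicalLearner (P : List (X × Y) → PMF (X → Y))
    (A : Adversary (classicalLearner P)) (r : List ((X → Y) × (X × Y))) :
    learnerLoss (L := classicalLearner P) A r = playedRisk A r := by
  induction r with
  | nil => rfl
  | cons e r ih => exact congrArg (fun x => risk (A r) e.1 + x) ih

theorem fixedLoss_classicalLearner (P : List (X × Y) → PMF (X → Y))
    (A : Adversary (classicalLearner P)) (g : X → Y) (r : List ((X → Y) × (X × Y))) :
    fixedLoss (L := classicalLearner P) A g r = totalRisk A g r := by
  induction r with
  | nil => rfl
  | cons e r ih => exact congrArg (fun x => risk (A r) g + x) ih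

theorem totalRisk_nonneg (A : List ((X → Y) × (X × Y)) → PMF (X × Y)) (g : X → Y)
    (r : List ((X → Y) × (X × Y))) : 0 ≤ totalRisk A g r := by
  induction r with
  | nil => exact le_rfl
  | cons e r ih => exact add_nonneg (risk_mem _ _).1 ih

theorem sampleLoss_le (g : X → Y) (zs : List (X × Y)) : sampleLoss g zs ≤ zs.length := by
  induction zs with
  | nil => simp [sampleLoss]
  | cons z zs ih =>
    simp only [sampleLoss, List.length_cons, Nat.cast_add, Nat.cast_one]
    linarith [labelLoss_le_one (g z.1) z.2]

theorem expectedAgnosticRegret_classicalLearner (H : Set (X → Y))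
    (P : List (X × Y) → PMF (X → Y)) (A : Adversary (classicalLearner P)) (T : ℕ) :
    HasSum (fun r : List.Vector ((X → Y) × (X × Y)) T => (recordWeight P A r.toList).toReal *
        (playedRisk A r.toList - ⨅ g : H, totalRisk A g.1 r.toList))
      (expectedAgnosticRegret H (classicalLearner P) A T) := by
  have h := (summable_expectedRegret H (classicalLearner P) A T).hasSum
  have hpt : ∀ r : List.Vector ((X → Y) × (X × Y)) T,
      ((classicalLearner P).law A T r).toReal *
        agnosticRegret (L := classicalLearner P) H A r.toList =
      (recordWeight P A r.toList).toReal *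
        (playedRisk A r.toList - ⨅ g : H, totalRisk A g.1 r.toList) := fun r => by
    have h₁ : agnosticRegret (L := classicalLearner P) H A r.toList =
        playedRisk A r.toList - ⨅ g : H, totalRisk A g.1 r.toList :=
      congrArg₂ (· - ·) (learnerLoss_classicalLearner P A r.toList)
        (iInf_congr fun g => fixedLoss_classicalLearner P A g.1 r.toList)
    rw [h₁, law_classicalLearner]
  exact (funext hpt : _ = _) ▸ h

theorem hasSum_recordExpectation (P : List (X × Y) → PMF (X → Y))
    (A : List ((X → Y) × (X × Y)) → PMF (X × Y)) (T : ℕ)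
    {F : List ((X → Y) × (X × Y)) → ℝ≥0∞} (hF : recordExpectation P A T F ≠ ∞) :
    HasSum (fun r : List.Vector ((X → Y) × (X × Y)) T =>
        (recordWeight P A r.toList).toReal * (F r.toList).toReal)
      (recordExpectation P A T F).toReal := by
  have h := ENNReal.hasSum_toReal hF
  rw [← ENNReal.tsum_toReal_eq fun r => ENNReal.ne_top_of_tsum_ne_top hF r] at h
  simp only [ENNReal.toReal_mul] at h
  exact h

/-- The regret is split into the regret of the randomized predictions on the sampled examples, at
most `K / a`, and the largest deviation of a number of mistakes from its conditional expectation,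
whose exponential moment is at most `B`. -/
theorem expectedAgnosticRegret_le_of_mixture (P : List (X × Y) → PMF (X → Y))
    (A : List ((X → Y) × (X × Y)) → PMF (X × Y)) (T : ℕ) {H : Set (X → Y)} (hH : H.Nonempty)
    {a K B : ℝ} (ha : 0 < a) (hB : 0 < B)
    (hK : ∀ g ∈ H, ∀ zs : List (X × Y), zs.length = T →
      a * totalMixtureLoss P zs ≤ a * sampleLoss g zs + K)
    (hdev : recordExpectation P A T (fun r => ⨆ g, H.indicator 1 g *
        expENN (a * (sampleLoss g (r.map Prod.snd) - totalRisk A g r))) ≤ ENNReal.ofReal B) :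
    expectedAgnosticRegret H (classicalLearner P) A T ≤ (K + Real.log B) / a := by
  have : Nonempty H := hH.to_subtype
  set M : List ((X → Y) × (X × Y)) → ℝ≥0∞ := fun r => ⨆ g, H.indicator 1 g *
    expENN (a * (sampleLoss g (r.map Prod.snd) - totalRisk A g r))
  have hMsum := hasSum_recordExpectation P A T (ne_top_of_le_ne_top ENNReal.ofReal_ne_top hdev)
  have hMle : (recordExpectation P A T M).toReal ≤ B := ENNReal.toReal_le_of_le_ofReal hB.le hdev
  have hone := hasSum_recordExpectation P A T (F := fun _ => 1)
    (by rw [recordExpectation_one]; exact ENNReal.one_ne_top)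
  rw [recordExpectation_one] at hone
  have hmixtop : recordExpectation P A T
      (fun r => ENNReal.ofReal (totalMixtureLoss P (r.map Prod.snd))) ≠ ∞ := by
    have hb : recordExpectation P A T
        (fun r => ENNReal.ofReal (totalMixtureLoss P (r.map Prod.snd))) ≤
          ∑' r : List.Vector ((X → Y) × (X × Y)) T, recordWeight P A r.toList * 1 * T := by
      refine ENNReal.tsum_le_tsum fun r => ?_
      rw [mul_one]
      refine mul_le_mul_right (ENNReal.ofReal_le_of_le_toReal ?_) _
      simpa using (totalMixtureLoss_mem P (r.toList.map Prod.snd)).2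
    rw [ENNReal.tsum_mul_right] at hb
    refine ne_top_of_le_ne_top ?_ hb
    have h1 := recordExpectation_one P A T
    rw [recordExpectation] at h1
    rw [h1, one_mul]
    exact ENNReal.natCast_ne_top T
  have hmix := hasSum_recordExpectation P A T hmixtop
  have hplay := hasSum_recordExpectation P A T
    (F := fun r => ENNReal.ofReal (playedRisk A r))
    (by rw [recordExpectation_playedRisk]; exact hmixtop)
  rw [recordExpectation_playedRisk] at hplay
  have hpoint : ∀ r : List.Vector ((X → Y) × (X × Y)) T,
      totalMixtureLoss P (r.toList.map Prod.snd) - ⨅ g : H, totalRisk A g.1 r.toList ≤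
        (K + Real.log B - 1) / a + (M r.toList).toReal * (a * B)⁻¹ := by
    intro r
    have hMtop : M r.toList ≠ ∞ := by
      refine ne_top_of_le_ne_top (b := expENN (a * T)) ENNReal.ofReal_ne_top
        (iSup_le fun g => ?_)
      refine le_trans (mul_le_of_le_one_left' (Set.indicator_apply_le' (fun _ => le_rfl)
        (fun _ => zero_le_one))) ?_
      refine ENNReal.ofReal_le_ofReal (Real.exp_le_exp.2 (mul_le_mul_of_nonneg_left ?_ ha.le))
      have h₁ := sampleLoss_le g (r.toList.map Prod.snd)
      rw [List.length_map, r.toList_length] at h₁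
      linarith [totalRisk_nonneg A g r.toList]
    have hg : ∀ g : H, totalMixtureLoss P (r.toList.map Prod.snd) -
        ((K + Real.log B - 1) / a + (M r.toList).toReal * (a * B)⁻¹) ≤
          totalRisk A g.1 r.toList := by
      rintro ⟨g, hg⟩
      have h₁ := hK g hg (r.toList.map Prod.snd) (by simp)
      set D := sampleLoss g (r.toList.map Prod.snd) - totalRisk A g r.toList with hD
      have h₂ : Real.exp (a * D) ≤ (M r.toList).toReal := by
        refine (ENNReal.ofReal_le_iff_le_toReal hMtop).1 ?_
        refine le_trans ?_ (le_iSup (fun g => H.indicator 1 g *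
          expENN (a * (sampleLoss g (r.toList.map Prod.snd) - totalRisk A g r.toList))) g)
        rw [Set.indicator_of_mem hg, Pi.one_apply, one_mul]
        rfl
      -- the tangent of the logarithm at `B`
      have h₃ : a * D ≤ Real.log B - 1 + Real.exp (a * D) / B := by
        have := Real.add_one_le_exp (a * D - Real.log B)
        rw [Real.exp_sub, Real.exp_log hB] at this
        linarith
      have h₄ : Real.exp (a * D) / B ≤ (M r.toList).toReal / B :=
        div_le_div_of_nonneg_right h₂ hB.le
      have h₅ : (K + Real.log B - 1) / a + (M r.toList).toReal * (a * B)⁻¹ =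
          (K + Real.log B - 1 + (M r.toList).toReal / B) / a := by
        field_simp
      rw [h₅, sub_le_iff_le_add, ← sub_le_iff_le_add', le_div_iff₀ ha]
      have h₆ : a * D = a * sampleLoss g (r.toList.map Prod.snd) -
        a * totalRisk A g r.toList := by rw [hD]; ring
      linarith
    linarith [le_ciInf hg]
  have hsum := ((hplay.sub hmix).add (hone.mul_right ((K + Real.log B - 1) / a))).add
    (hMsum.mul_right (a * B)⁻¹)
  have hle := hasSum_le (fun r => ?_) (expectedAgnosticRegret_classicalLearner H P A T) hsum
  · refine hle.trans ?_
    have h₁ : (recordExpectation P A T M).toReal * (a * B)⁻¹ ≤ B * (a * B)⁻¹ :=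
      mul_le_mul_of_nonneg_right hMle (by positivity)
    have h₂ : B * (a * B)⁻¹ = 1 / a := by field_simp
    have h₃ : (K + Real.log B) / a = (K + Real.log B - 1) / a + 1 / a := by ring
    simp only [sub_self, zero_add, ENNReal.toReal_one, one_mul]
    linarith
  · have hw : 0 ≤ (recordWeight P A r.toList).toReal := ENNReal.toReal_nonneg
    have := mul_le_mul_of_nonneg_left (hpoint r) hw
    rw [ENNReal.toReal_ofReal (playedRisk_nonneg A _),
      ENNReal.toReal_ofReal (totalMixtureLoss_mem P _).1, ENNReal.toReal_one, mul_one]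
    linarith

theorem expectedAgnosticRegret_hedge_le [Fintype Y] [Nonempty Y] {H : Set (X → Y)}
    (hH : H.Nonempty) {d : ℕ} (hd : ¬ Shatters (d + 1) H) {a : ℝ} (ha : 0 < a) {b : ℝ}
    (hb : 0 < b) (hb₁ : b ≤ 1) (T : ℕ) (A : Adversary (classicalLearner (hedge a hb H))) :
    expectedAgnosticRegret H (classicalLearner (hedge a hb H)) A T ≤
      (T * (Fintype.card Y * b + a ^ 2) - d * Real.log b +
        (T * (a ^ 2 / 2) + d * Real.log (1 + Fintype.card Y * (2 * T)))) / a := by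
  set s : ℝ := 1 + Fintype.card Y * (2 * T) with hs
  have hs₀ : 0 < s := by positivity
  have hlog : Real.log (Real.exp (T * (a ^ 2 / 2)) * s ^ d) =
      T * (a ^ 2 / 2) + d * Real.log s := by
    rw [Real.log_mul (Real.exp_ne_zero _) (pow_ne_zero _ hs₀.ne'), Real.log_exp, Real.log_pow]
  rw [← hlog]
  refine expectedAgnosticRegret_le_of_mixture _ A T hH ha (by positivity) ?_ ?_
  · intro g hg zs hzs
    have := mul_totalMixtureLoss_hedge_le ha.le hb hb₁ hd hg zs
    rw [hzs] at this
    linarith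
  · refine (recordExpectation_deviation_le _ A a T H).trans ?_
    rw [ENNReal.ofReal_mul (Real.exp_nonneg _), Real.exp_nat_mul,
      ENNReal.ofReal_pow (Real.exp_nonneg _)]
    refine mul_le_mul' (pow_le_pow_left' (ENNReal.ofReal_le_ofReal
      (Real.cosh_le_exp_half_sq a)) T) ((sauerBound_le hd).trans ?_)
    have hle : ((sauerNumber (Nat.card Y) (2 * T) (d + 1) : ℕ) : ℝ) ≤ s ^ d := by
      rw [hs, ← Nat.card_eq_fintype_card]
      exact_mod_cast sauerNumber_succ_le (Nat.card Y) (2 * T) d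
    rw [← ENNReal.ofReal_natCast]
    exact ENNReal.ofReal_le_ofReal hle

/-- If `g` is the only hypothesis, then the learner that always plays `g` has no regret. -/
theorem expectedAgnosticRegret_pure_le (g : X → Y)
    (A : Adversary (classicalLearner (fun _ : List (X × Y) => PMF.pure g))) (T : ℕ) :
    expectedAgnosticRegret {g} (classicalLearner fun _ => PMF.pure g) A T ≤ 0 := by
  have hplay : ∀ r, recordWeight (fun _ => PMF.pure g) A r ≠ 0 →
      playedRisk A r = totalRisk A g r := by
    intro r
    induction r with
    | nil => exact fun _ => rfl
    | cons e r ih =>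
      intro hr
      simp only [recordWeight, ne_eq, mul_eq_zero, not_or] at hr
      have he : e.1 = g := by
        by_contra hne
        exact hr.2.1 (PMF.pure_apply_of_ne g e.1 hne)
      exact congrArg₂ (· + ·) (congrArg (risk (A r)) he) (ih hr.1)
  refine (expectedAgnosticRegret_classicalLearner {g} (fun _ => PMF.pure g) A T).nonpos fun r => ?_
  by_cases hr : recordWeight (fun _ => PMF.pure g) A r.toList = 0
  · simp [hr]
  · rw [hplay _ hr, ciInf_unique]
    exact (by simp : _ * (totalRisk A g r.toList - totalRisk A g r.toList) = 0).le

end Regret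

theorem mainTheorem3 :
    ∃ C : ℝ, 0 < C ∧
      ∀ (X : Type u) (Y : Type v) [Finite Y] (k : ℕ) (_ : Nat.card Y = k) (_ : 2 < k)
        (H : Set (X → Y)) (_ : H.Nonempty) (d : ℕ) (_ : mcLdim H = d) (T : ℕ) (_ : 2 ≤ T),
        ∃ L : QuantumLearner X Y, ∀ A : Adversary L,
          expectedAgnosticRegret H L A T ≤
            C * Real.sqrt (d * (T * Real.log T) * (k * Real.log k)) := by
  refine ⟨11, by norm_num, ?_⟩
  intro X Y _ k hk hk₂ H hH d hd T hT
  have hsh := not_shatters_of_mcLdim_eq hd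
  have := Fintype.ofFinite Y
  have hcard : Fintype.card Y = k := by rw [← Nat.card_eq_fintype_card, hk]
  have : Nonempty Y := Fintype.card_pos_iff.1 (by omega)
  rcases Nat.eq_zero_or_pos d with rfl | hdpos
  · obtain ⟨g, hg⟩ := hH
    obtain rfl : H = {g} := (subsingleton_of_not_shatters_one hsh).eq_singleton_of_mem hg
    refine ⟨classicalLearner fun _ => PMF.pure g, fun A => ?_⟩
    exact (expectedAgnosticRegret_pure_le g A T).trans (by positivity)
  · have hk₃ : (3 : ℝ) ≤ k := by exact_mod_cast hk₂
    have hT₂ : (2 : ℝ) ≤ T := by exact_mod_cast hT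
    have hd₁ : (1 : ℝ) ≤ d := by exact_mod_cast hdpos
    have hkT : (6 : ℝ) ≤ k * T := by nlinarith
    have hlogk : 1 ≤ Real.log k := by
      rw [Real.le_log_iff_exp_le (by linarith)]
      linarith [Real.exp_one_lt_d9]
    have hlogT : 0.69 ≤ Real.log T :=
      (by linarith [Real.log_two_gt_d9] : (0.69 : ℝ) ≤ Real.log 2).trans
        (Real.log_le_log (by norm_num) hT₂)
    have hlog : Real.log (k * T) = Real.log k + Real.log T :=
      Real.log_mul (by positivity) (by positivity)
    set W : ℝ := d * Real.log (k * T) with hW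
    have hW₁ : 1 ≤ W := by
      rw [hW, hlog]
      nlinarith
    have hWpos : 0 < W := by linarith
    have hTpos : (0 : ℝ) < T := by linarith
    -- the learning rate balances `W / a` against `T * a`
    set a : ℝ := Real.sqrt (W / T) with ha
    have hapos : 0 < a := Real.sqrt_pos.2 (by positivity)
    have hasq : T * a ^ 2 = W := by
      rw [ha, Real.sq_sqrt (by positivity)]
      field_simp
    have hb : (0 : ℝ) < (k * T : ℝ)⁻¹ := by positivity
    refine ⟨classicalLearner (hedge a hb H), fun A => ?_⟩
    refine (expectedAgnosticRegret_hedge_le hH hsh hapos hb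
      (inv_le_one_of_one_le₀ (by linarith)) T A).trans ?_
    rw [hcard, Real.log_inv]
    have hkb : (T : ℝ) * (k * (k * T : ℝ)⁻¹) = 1 := by
      field_simp
    have hlog₂ : Real.log (1 + k * (2 * T)) ≤ 2 * Real.log (k * T) := by
      have h : Real.log ((k * T : ℝ) ^ 2) = 2 * Real.log (k * T) := by
        rw [Real.log_pow]; norm_num
      rw [← h]
      exact Real.log_le_log (by positivity) (by nlinarith)
    have hdlog : d * Real.log (1 + k * (2 * T)) ≤ 2 * W := by
      rw [hW]; nlinarith
    have hnum : T * (k * (k * T : ℝ)⁻¹ + a ^ 2) - d * -Real.log (k * T) +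
        (T * (a ^ 2 / 2) + d * Real.log (1 + k * (2 * T))) ≤ 5.5 * W := by
      have h₁ : (T : ℝ) * (k * (k * T : ℝ)⁻¹ + a ^ 2) = 1 + W := by rw [mul_add, hkb, hasq]
      have h₂ : (T : ℝ) * (a ^ 2 / 2) = W / 2 := by rw [← hasq]; ring
      have h₃ : (d : ℝ) * -Real.log (k * T) = -W := by rw [hW]; ring
      rw [h₁, h₂, h₃]
      linarith
    have hWa : W / a = T * a := by
      rw [div_eq_iff hapos.ne', ← hasq]; ring
    have hTa : T * a ≤ 2 * Real.sqrt (d * (T * Real.log T) * (k * Real.log k)) := by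
      have hQ : T * W ≤ 2 ^ 2 * (d * (T * Real.log T) * (k * Real.log k)) := by
        have h₁ : Real.log k ≤ 3 * (Real.log T * (k * Real.log k)) := by
          have : 1 ≤ 3 * (Real.log T * k) := by nlinarith
          nlinarith
        have h₂ : Real.log T ≤ Real.log T * (k * Real.log k) := by
          have : 1 ≤ (k : ℝ) * Real.log k := by nlinarith
          nlinarith
        calc T * W = T * d * (Real.log k + Real.log T) := by rw [hW, hlog]; ring
          _ ≤ T * d * (4 * (Real.log T * (k * Real.log k))) := by
              gcongr
              linarith
          _ = _ := by ring
      have hsqrt : T * a = Real.sqrt (T * W) := by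
        rw [eq_comm, Real.sqrt_eq_iff_mul_self_eq (by positivity) (by positivity)]
        calc T * W = T * (T * a ^ 2) := by rw [hasq]
          _ = T * a * (T * a) := by ring
      rw [hsqrt, ← Real.sqrt_sq (by norm_num : (0 : ℝ) ≤ 2), ← Real.sqrt_mul (by norm_num)]
      exact Real.sqrt_le_sqrt hQ
    calc _ ≤ 5.5 * W / a := div_le_div_of_nonneg_right hnum hapos.le
      _ = 5.5 * (T * a) := by rw [mul_div_assoc, hWa]
      _ ≤ _ := by linarith
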